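/- For $r>0$ let $\mathrm{B}^2(r)\subset\mathbb{R}^2$ be the open disc of radius $r$ centred at the origin, with the area form $dx\wedge dy$. For $\epsilon>0$ let $$\Sigma(\epsilon):=(\mathbb{R}^2\setminus\sqrt\epsilon\,\mathbb{Z}^2)/\sqrt\epsilon\,\mathbb{Z}^2$$ be the punctured torus of area $\epsilon$, with the area form induced by $dx\wedge dy$; products carry the product symplectic forms. Theorem. There exist constants $\epsilon_0>0$ and $c>0$ and a smooth family $(I_\epsilon)_{\epsilon\in(0,\epsilon_0]}$ of symplectic embeddings $$I_\epsilon\colon \Sigma(\epsilon)\times \mathrm{B}^2(1)\hookrightarrow \mathrm{B}^2(\sqrt2+c\,\epsilon)\times \mathrm{B}^2(\sqrt2).$$ Here a symplectic embedding is a smooth embedding that pulls back the symplectic form of the target to that of the source. Smoothness of the family means that, after identifying $\Sigma(\epsilon)$ with $\Sigma(1)$ by scaling, the maps depend smoothly on all variables jointly, up to the end point $\epsilon_0$: there are an open set $U\subset\mathbb{R}$ containing $(0,\epsilon_0]$ and a smooth map $\Phi\colon U\times\Sigma(1)\times \mathrm{B}^2(1)\to\mathbb{R}^2\times\mathbb{R}^2$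 with $\Phi(\epsilon,[z],b)=I_\epsilon([\sqrt\epsilon\, z],b)$ for all $\epsilon\in(0,\epsilon_0]$, $[z]\in\Sigma(1)$ and $b\in \mathrm{B}^2(1)$. -/

import Mathlib

open scoped Manifold ContDiff

noncomputable section

/-! ### The smooth structure on the circle `ℝ / pℤ` -/

/-- The charts of `ℝ / pℤ` are the local inverses of the covering map `ℝ → ℝ / pℤ`. -/
instance AddCircle.instChartedSpaceReal (p : ℝ) : ChartedSpace ℝ (AddCircle p) :=
  (AddCircle.isLocalHomeomorph_coe p).chartedSpace QuotientAddGroup.mk_surjective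

/-- A chart of `ℝ / pℤ` composed with the covering map is locally a translation. -/
theorem AddCircle.atlas_comp_coe_eventuallyEq {p : ℝ}
    {e : OpenPartialHomeomorph (AddCircle p) ℝ} (he : e ∈ atlas ℝ (AddCircle p))
    {t : ℝ} (ht : (t : AddCircle p) ∈ e.source) :
    ∃ k : ℝ, ∀ᶠ s : ℝ in nhds t, e (s : AddCircle p) = s + k := by
  obtain ⟨q, rfl⟩ := he
  set hf := AddCircle.isLocalHomeomorph_coe p
  set g := (QuotientAddGroup.mk_surjective (s := AddSubgroup.zmultiples p)).hasRightInverse.choose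
  set e' := (hf.localInverseAt (g q)).trans (chartAt ℝ (g q)) with he'
  have hsrc : e'.source = (hf.localInverseAt (g q)).source := by simp [he', chartAt_self_eq]
  have happ : ∀ x, e' x = hf.localInverseAt (g q) x := fun x => by simp [he', chartAt_self_eq]
  have hright : ∀ x ∈ e'.source, ((e' x : ℝ) : AddCircle p) = x := by
    intro x hx
    rw [happ]
    exact hf.apply_localInverseAt_of_mem (hsrc ▸ hx)
  have hinj : e'.target.InjOn ((↑) : ℝ → AddCircle p) := by
    have : e'.target = (hf.localInverseAt (g q)).target := by simp [he', chartAt_self_eq]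
    rw [this]
    exact hf.injOn_localInverseAt_target
  refine ⟨e' t - t, ?_⟩
  have hk : ((e' t - t : ℝ) : AddCircle p) = 0 := by
    rw [AddCircle.coe_sub, hright _ ht, sub_self]
  have h1 : ∀ᶠ s : ℝ in nhds t, (s : AddCircle p) ∈ e'.source :=
    (AddCircle.continuous_mk' p).continuousAt.eventually (e'.open_source.mem_nhds ht)
  have h2 : ∀ᶠ s : ℝ in nhds t, s + (e' t - t) ∈ e'.target := by
    have hc : ContinuousAt (fun s : ℝ => s + (e' t - t)) t := by fun_prop
    refine hc.eventually (e'.open_target.mem_nhds ?_)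
    simpa using e'.map_source ht
  filter_upwards [h1, h2] with s hs1 hs2
  refine hinj (e'.map_source hs1) hs2 ?_
  rw [hright _ hs1, AddCircle.coe_add, hk, add_zero]

theorem AddCircle.coe_atlas_symm {p : ℝ}
    {e : OpenPartialHomeomorph (AddCircle p) ℝ} (he : e ∈ atlas ℝ (AddCircle p)) (t : ℝ) :
    e.symm t = (t : AddCircle p) := by
  obtain ⟨q, rfl⟩ := he
  simp [chartAt_self_eq]

instance AddCircle.instIsManifoldReal (p : ℝ) : IsManifold 𝓘(ℝ) ∞ (AddCircle p) := by
  refine isManifold_of_contDiffOn 𝓘(ℝ) ∞ (AddCircle p) ?_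
  intro e e' he he' t ht
  simp only [mfld_simps] at ht ⊢
  refine ContDiffAt.contDiffWithinAt ?_
  have ht' : (t : AddCircle p) ∈ e'.source := by
    rw [← AddCircle.coe_atlas_symm he]; exact ht.2
  obtain ⟨k, hk⟩ := AddCircle.atlas_comp_coe_eventuallyEq he' ht'
  refine ContDiffAt.congr_of_eventuallyEq (f := fun s : ℝ => s + k) (by fun_prop) ?_
  filter_upwards [hk] with s hs
  simp [AddCircle.coe_atlas_symm he, hs]

theorem AddCircle.contMDiff_coe (p : ℝ) :
    ContMDiff 𝓘(ℝ) 𝓘(ℝ) ∞ ((↑) : ℝ → AddCircle p) := by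
  intro t
  rw [contMDiffAt_iff]
  refine ⟨(AddCircle.continuous_mk' p).continuousAt, ?_⟩
  obtain ⟨k, hk⟩ := AddCircle.atlas_comp_coe_eventuallyEq
    (chart_mem_atlas ℝ (t : AddCircle p)) (mem_chart_source ℝ (t : AddCircle p))
  simp only [mfld_simps, chartAt_self_eq]
  refine ContDiffAt.contDiffWithinAt ?_
  refine ContDiffAt.congr_of_eventuallyEq (f := fun s : ℝ => s + k) (by fun_prop) ?_
  filter_upwards [hk] with s hs
  simpa using hs

/-- With the tangent space of `ℝ / pℤ` at a point identified with `ℝ` through the chart there, the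
derivative of the covering map is the identity. -/
theorem AddCircle.mfderiv_coe (p t : ℝ) :
    mfderiv 𝓘(ℝ) 𝓘(ℝ) ((↑) : ℝ → AddCircle p) t = ContinuousLinearMap.id ℝ ℝ := by
  obtain ⟨k, hk⟩ := AddCircle.atlas_comp_coe_eventuallyEq
    (chart_mem_atlas ℝ (t : AddCircle p)) (mem_chart_source ℝ (t : AddCircle p))
  rw [((AddCircle.contMDiff_coe p).mdifferentiable (by simp) t).mfderiv]
  simp only [mfld_simps, chartAt_self_eq, fderivWithin_univ]
  have : (writtenInExtChartAt 𝓘(ℝ) 𝓘(ℝ) t ((↑) : ℝ → AddCircle p))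
      =ᶠ[nhds t] fun s : ℝ => s + k := by
    filter_upwards [hk] with s hs
    simpa [writtenInExtChartAt, chartAt_self_eq] using hs
  have h2 : fderiv ℝ (writtenInExtChartAt 𝓘(ℝ) 𝓘(ℝ) t ((↑) : ℝ → AddCircle p)) t
      = ContinuousLinearMap.id ℝ ℝ := by
    rw [this.fderiv_eq]
    simp [fderiv_add_const]
  exact h2

/-! ### Two-forms, symplectic embeddings -/

section General

variable {E H : Type*} [NormedAddCommGroup E] [NormedSpace ℝ E] [TopologicalSpace H]
  {E' H' : Type*} [NormedAddCommGroup E'] [NormedSpace ℝ E'] [TopologicalSpace H']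

/-- A field of real-valued functions of two tangent vectors; the two-forms below are of this kind. -/
abbrev FormField (I : ModelWithCorners ℝ E H) (M : Type*) [TopologicalSpace M]
    [ChartedSpace H M] : Type _ :=
  ∀ x : M, TangentSpace I x → TangentSpace I x → ℝ

/-- The pull-back `f^* β`. -/
def FormField.pullback {I : ModelWithCorners ℝ E H} {J : ModelWithCorners ℝ E' H'}
    {M N : Type*} [TopologicalSpace M] [ChartedSpace H M] [TopologicalSpace N] [ChartedSpace H' N]
    (β : FormField J N) (f : M → N) : FormField I M :=
  fun x u v => β (f x) (mfderiv I J f x u) (mfderiv I J f x v)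

/-- The product form `pr₁^* α + pr₂^* β`. -/
def FormField.prod {I : ModelWithCorners ℝ E H} {J : ModelWithCorners ℝ E' H'}
    {M N : Type*} [TopologicalSpace M] [ChartedSpace H M] [TopologicalSpace N] [ChartedSpace H' N]
    (α : FormField I M) (β : FormField J N) : FormField (I.prod J) (M × N) :=
  fun x u v => α.pullback (I := I.prod J) Prod.fst x u v + β.pullback (I := I.prod J) Prod.snd x u v

/-- A symplectic embedding `f : (M, α) → (N, β)`: a smooth embedding with `f^* β = α`. -/
structure IsSymplecticEmbedding {I : ModelWithCorners ℝ E H} {J : ModelWithCorners ℝ E' H'}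
    {M N : Type*} [TopologicalSpace M] [ChartedSpace H M] [TopologicalSpace N] [ChartedSpace H' N]
    (α : FormField I M) (β : FormField J N) (f : M → N) : Prop where
  contMDiff : ContMDiff I J ∞ f
  immersion : ∀ x, Function.Injective (mfderiv I J f x)
  isEmbedding : Topology.IsEmbedding f
  pullback_eq : β.pullback f = α

/-- Smoothness of a family of maps `φ p : X p → M`, `p ∈ P ⊆ ℝ`, whose domains are parametrized by
`g p : B → X p` with a fixed manifold `B`: the map `(p, b) ↦ φ p (g p b)` on `P × B` extends to a
smooth map on `U × B` for some open neighbourhood `U` of `P`. -/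
def IsSmoothFamily (I : ModelWithCorners ℝ E H) (J : ModelWithCorners ℝ E' H')
    {B M : Type*} [TopologicalSpace B] [ChartedSpace H B] [TopologicalSpace M] [ChartedSpace H' M]
    (P : Set ℝ) {X : ℝ → Type*} (g : ∀ p ∈ P, B → X p) (φ : ∀ p, X p → M) : Prop :=
  ∃ (U : Set ℝ) (Φ : ℝ × B → M), IsOpen U ∧ P ⊆ U ∧
    ContMDiffOn (𝓘(ℝ).prod I) J ∞ Φ (U ×ˢ Set.univ) ∧
    ∀ p (hp : p ∈ P) (b : B), Φ (p, b) = φ p (g p hp b)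

end General

/-! ### The plane, discs, and punctured tori -/

/-- The area form `dx ∧ dy` on `ℝ²`. -/
def planeForm : FormField 𝓘(ℝ, ℝ × ℝ) (ℝ × ℝ) :=
  fun _ (u v : ℝ × ℝ) => u.1 * v.2 - u.2 * v.1

/-- The open disc `B²(r)` of radius `r` centred at the origin of `ℝ²`. -/
def disc (r : ℝ) : TopologicalSpace.Opens (ℝ × ℝ) where
  carrier := {z | Real.sqrt (z.1 ^ 2 + z.2 ^ 2) < r}
  is_open' := isOpen_lt (by fun_prop) continuous_const

/-- The restriction of `dx ∧ dy` to the disc. -/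
def discForm (r : ℝ) : FormField 𝓘(ℝ, ℝ × ℝ) (disc r) :=
  planeForm.pullback (Subtype.val : disc r → ℝ × ℝ)

/-- The torus `ℝ² / aℤ²`, with the product smooth structure. -/
abbrev Torus (a : ℝ) : Type := AddCircle a × AddCircle a

/-- The covering map `ℝ² → ℝ² / aℤ²`. -/
def torusProj (a : ℝ) : ℝ × ℝ → Torus a := fun z => ((z.1 : AddCircle a), (z.2 : AddCircle a))

/-- The area form on `ℝ² / aℤ²` induced by `dx ∧ dy`. The tangent space at a point is `ℝ × ℝ`
through the chart at that point, which is a local inverse of the covering map; the characterization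
`torusProj^* (torusForm a) = dx ∧ dy` is proved in `torusForm_pullback_torusProj` below. -/
def torusForm (a : ℝ) : FormField (𝓘(ℝ).prod 𝓘(ℝ)) (Torus a) :=
  fun _ (u v : ℝ × ℝ) => u.1 * v.2 - u.2 * v.1

theorem torusForm_pullback_torusProj (a : ℝ) :
    (torusForm a).pullback (I := 𝓘(ℝ).prod 𝓘(ℝ)) (torusProj a)
      = fun _ (u v : ℝ × ℝ) => u.1 * v.2 - u.2 * v.1 := by
  funext x u v
  have h1 : ∀ t : ℝ, MDifferentiableAt 𝓘(ℝ) 𝓘(ℝ) ((↑) : ℝ → AddCircle a) t := fun t =>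
    (AddCircle.contMDiff_coe a).mdifferentiable (by simp) t
  have h := mfderiv_prodMap (p := x) (h1 x.1) (h1 x.2)
  have h2 : ∀ w : ℝ × ℝ, mfderiv (𝓘(ℝ).prod 𝓘(ℝ)) (𝓘(ℝ).prod 𝓘(ℝ)) (torusProj a) x w = w := by
    intro w
    change mfderiv (𝓘(ℝ).prod 𝓘(ℝ)) (𝓘(ℝ).prod 𝓘(ℝ))
      (Prod.map ((↑) : ℝ → AddCircle a) ((↑) : ℝ → AddCircle a)) x w = w
    rw [h, AddCircle.mfderiv_coe, AddCircle.mfderiv_coe]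
    rfl
  change torusForm a _ (mfderiv _ _ _ x u) (mfderiv _ _ _ x v) = _
  rw [h2 u, h2 v]
  rfl

/-- The punctured torus `(ℝ² \ aℤ²) / aℤ²`, as an open subset of `ℝ² / aℤ²`. -/
def puncturedTorus (a : ℝ) : TopologicalSpace.Opens (Torus a) where
  carrier := {0}ᶜ
  is_open' := isOpen_compl_singleton

/-- The area form of the punctured torus, of total area `a²`. -/
def puncturedTorusForm (a : ℝ) : FormField (𝓘(ℝ).prod 𝓘(ℝ)) (puncturedTorus a) :=
  (torusForm a).pullback (Subtype.val : puncturedTorus a → Torus a)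

/-- The scaling diffeomorphism `[z] ↦ [a z]` from `(ℝ² \ ℤ²) / ℤ²` to `(ℝ² \ aℤ²) / aℤ²`. -/
def puncturedTorusScale (a : ℝ) (ha : 0 < a) (σ : puncturedTorus 1) : puncturedTorus a :=
  ⟨(AddCircle.equivAddCircle 1 a one_ne_zero ha.ne' σ.1.1,
    AddCircle.equivAddCircle 1 a one_ne_zero ha.ne' σ.1.2), by
    have h := σ.2
    simp only [puncturedTorus, TopologicalSpace.Opens.mem_mk, Set.mem_compl_iff,
      Set.mem_singleton_iff, Prod.ext_iff, Prod.fst_zero, Prod.snd_zero,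
      EmbeddingLike.map_eq_zero_iff] at h ⊢
    exact h⟩

end

/-!
Open every lattice point radially to a round hole of radius `√2 / 3`; this multiplies the area form
by a periodic density. In the coordinates `x + y` and `y - x` the torus becomes the strip
`ℝ / 2ℤ × [0, 1)`, whose edges are glued by `(q, v) ↦ (q + 1, v + 1)`, and the holes leave of the
gluing only the windows `|q - (2j + 1)| < 1 / 3`. Measuring the vertical coordinate by the integral
of the density makes the area form constant, and `B²(1)` is mapped to the rectangle
`(0, π) × (0, 1)`, which in action-angle coordinates is a half of the disc `B²(√2)`.

The strip, now of width of order `ε`, is wound around an annulus of area about `2π`, so that the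
strands over `q` and `q + 1` lie over the same angle. At `q = 0` the second lies above the first and
at `q = 1` below it, so they have to change sides once. They may do so where the half disc over one
of them has been rotated by `π`, since the half discs are then disjoint. Rotating by an angle `T q`
is kept symplectic by adding `T' q * R` to the coordinate across the annulus, where `R < 1` is the
momentum in the second factor. This costs an area of `π` for each of the two rotations, which is
the area `2π` of the annulus, up to the width of the strip.
-/

noncomputable section

namespace PuncturedTorus

/-! ### Smooth profiles of one variable -/

/-- A smooth staircase of period two: it rises by one over `[2m, 2m + 1/24]` for each integer `m`
and is constant in between. -/
def staircase (p : ℝ) : ℝ := ⌊p / 2⌋ + Real.smoothTransition (24 * (p - 2 * ⌊p / 2⌋))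

theorem staircase_eq_add_smoothTransition (m : ℤ) {p : ℝ} (h₁ : 2 * m - 47 / 24 ≤ p)
    (h₂ : p < 2 * m + 2) : staircase p = m + Real.smoothTransition (24 * (p - 2 * m)) := by
  rcases le_or_gt (2 * (m : ℝ)) p with h | h
  · have hfloor : ⌊p / 2⌋ = m := by
      rw [Int.floor_eq_iff]; constructor <;> linarith
    rw [staircase, hfloor]
  · have hfloor : ⌊p / 2⌋ = m - 1 := by
      rw [Int.floor_eq_iff]; push_cast; constructor <;> linarith
    rw [staircase, hfloor, Real.smoothTransition.zero_of_nonpos (x := 24 * (p - 2 * m))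
      (by linarith), Real.smoothTransition.one_of_one_le (by push_cast; linarith)]
    push_cast; ring

theorem staircase_eq_intCast (m : ℤ) {p : ℝ} (h₁ : 2 * m - 47 / 24 ≤ p) (h₂ : p ≤ 2 * m) :
    staircase p = m := by
  rw [staircase_eq_add_smoothTransition m h₁ (by linarith),
    Real.smoothTransition.zero_of_nonpos (by linarith), add_zero]

theorem staircase_add_two (p : ℝ) : staircase (p + 2) = staircase p + 1 := by
  have hfloor : ⌊(p + 2) / 2⌋ = ⌊p / 2⌋ + 1 := by
    rw [← Int.floor_add_one]; congr 1; ring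
  unfold staircase
  rw [hfloor]; push_cast
  rw [show p + 2 - 2 * ((⌊p / 2⌋ : ℝ) + 1) = p - 2 * ⌊p / 2⌋ by ring]; ring

theorem exists_staircase_eventuallyEq (p : ℝ) :
    ∃ m : ℤ, staircase =ᶠ[nhds p] fun p ↦ m + Real.smoothTransition (24 * (p - 2 * m)) := by
  refine ⟨⌊p / 2⌋, ?_⟩
  have h₁ := Int.floor_le (p / 2)
  have h₂ := Int.lt_floor_add_one (p / 2)
  filter_upwards [Ioo_mem_nhds (a := 2 * (⌊p / 2⌋ : ℝ) - 47 / 24) (b := 2 * (⌊p / 2⌋ : ℝ) + 2)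
    (by linarith) (by linarith)] with x hx
  exact staircase_eq_add_smoothTransition _ hx.1.le hx.2

theorem contDiff_smoothTransition_comp {f : ℝ → ℝ} (hf : ContDiff ℝ ∞ f) :
    ContDiff ℝ ∞ fun x ↦ Real.smoothTransition (f x) :=
  Real.smoothTransition.contDiff.comp hf

theorem contDiff_staircase : ContDiff ℝ ∞ staircase := by
  rw [contDiff_iff_contDiffAt]
  intro p
  obtain ⟨m, hm⟩ := exists_staircase_eventuallyEq p
  exact (contDiff_const.add (contDiff_smoothTransition_comp (by fun_prop))).contDiffAt
    |>.congr_of_eventuallyEq hm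

theorem differentiable_staircase : Differentiable ℝ staircase :=
  contDiff_staircase.differentiable (by simp)

theorem contDiff_deriv_staircase : ContDiff ℝ ∞ (deriv staircase) :=
  (contDiff_infty_iff_deriv.1 contDiff_staircase).2

theorem deriv_staircase_nonneg (p : ℝ) : 0 ≤ deriv staircase p := by
  obtain ⟨m, hm⟩ := exists_staircase_eventuallyEq p
  rw [hm.deriv_eq]
  refine Monotone.deriv_nonneg fun x y hxy ↦ ?_
  have := Real.smoothTransition.monotone (a := 24 * (x - 2 * m)) (b := 24 * (y - 2 * m))
    (by linarith)
  simpa using this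

theorem monotone_staircase : Monotone staircase :=
  monotone_of_deriv_nonneg differentiable_staircase deriv_staircase_nonneg

theorem deriv_staircase_add_two (p : ℝ) : deriv staircase (p + 2) = deriv staircase p := by
  rw [← deriv_comp_add_const, funext staircase_add_two, deriv_add_const]

theorem deriv_staircase_eq_zero (m : ℤ) {p : ℝ} (h₁ : 2 * m - 47 / 24 < p) (h₂ : p < 2 * m) :
    deriv staircase p = 0 := by
  have hconst : staircase =ᶠ[nhds p] fun _ ↦ (m : ℝ) := by
    filter_upwards [Ioo_mem_nhds h₁ h₂] with x hx
    exact staircase_eq_intCast m hx.1.le hx.2.le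
  rw [hconst.deriv_eq, deriv_const]

/-- The action on squared radii of the map that collapses a hole of radius `√2 / 3` to a point: an
increasing smooth function with `collapse (2 / 9) = 0` and `collapse t = t` for `17 / 72 ≤ t`. -/
def collapse (t : ℝ) : ℝ := t - 2 / 9 * (1 - Real.smoothTransition (72 * t - 16))

theorem contDiff_collapse : ContDiff ℝ ∞ collapse :=
  contDiff_id.sub (contDiff_const.mul
    (contDiff_const.sub (contDiff_smoothTransition_comp (by fun_prop))))

theorem differentiable_collapse : Differentiable ℝ collapse :=
  contDiff_collapse.differentiable (by simp)

theorem collapse_of_ge {t : ℝ} (h : 17 / 72 ≤ t) : collapse t = t := by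
  rw [collapse, Real.smoothTransition.one_of_one_le (by linarith)]; ring

theorem collapse_two_ninths : collapse (2 / 9) = 0 := by
  rw [collapse, Real.smoothTransition.zero_of_nonpos (by norm_num)]; ring

theorem one_le_deriv_collapse (t : ℝ) : 1 ≤ deriv collapse t := by
  have hmono : Monotone fun t ↦ collapse t - t := by
    intro x y hxy
    have := Real.smoothTransition.monotone (a := 72 * x - 16) (b := 72 * y - 16) (by linarith)
    simp only [collapse]; linarith
  have hderiv := hmono.deriv_nonneg (x := t)
  rwa [deriv_fun_sub (differentiable_collapse t) differentiableAt_fun_id, deriv_id'',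
    sub_nonneg] at hderiv

theorem deriv_collapse_of_gt {t : ℝ} (h : 17 / 72 < t) : deriv collapse t = 1 := by
  have hid : collapse =ᶠ[nhds t] id := by
    filter_upwards [Ioi_mem_nhds h] with x hx
    exact collapse_of_ge (le_of_lt hx)
  rw [hid.deriv_eq, deriv_id]

theorem deriv_collapse_pos (t : ℝ) : 0 < deriv collapse t :=
  zero_lt_one.trans_le (one_le_deriv_collapse t)

theorem strictMono_collapse : StrictMono collapse := strictMono_of_deriv_pos deriv_collapse_pos

theorem surjective_collapse : Function.Surjective collapse := by
  refine contDiff_collapse.continuous.surjective ?_ ?_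
  · refine Filter.tendsto_atTop_mono' _ ?_ Filter.tendsto_id
    filter_upwards [Filter.eventually_ge_atTop (17 / 72)] with t ht
    exact (collapse_of_ge ht).ge
  · refine Filter.tendsto_atBot_mono (fun t ↦ ?_) Filter.tendsto_id
    have := Real.smoothTransition.le_one (72 * t - 16)
    simp only [collapse, id]; linarith

/-- `collapse` as an order isomorphism, introduced for the sake of its inverse. -/
def collapseOrderIso : ℝ ≃o ℝ := strictMono_collapse.orderIsoOfSurjective _ surjective_collapse

/-- The inverse of `collapse`: the action on squared radii of the map that opens a point to a hole
of radius `√2 / 3`. -/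
def inflate (s : ℝ) : ℝ := collapseOrderIso.symm s

theorem collapse_inflate (s : ℝ) : collapse (inflate s) = s := collapseOrderIso.apply_symm_apply s

theorem inflate_collapse (t : ℝ) : inflate (collapse t) = t := collapseOrderIso.symm_apply_apply t

theorem contDiff_inflate : ContDiff ℝ ∞ inflate :=
  collapseOrderIso.toHomeomorph.contDiff_symm_deriv (fun t ↦ (deriv_collapse_pos t).ne')
    (fun t ↦ (differentiable_collapse t).hasDerivAt) contDiff_collapse

theorem strictMono_inflate : StrictMono inflate := collapseOrderIso.symm.strictMono

theorem inflate_of_ge {s : ℝ} (h : 17 / 72 ≤ s) : inflate s = s := by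
  conv_lhs => rw [← collapse_of_ge h]
  exact inflate_collapse s

theorem inflate_zero : inflate 0 = 2 / 9 := by rw [← collapse_two_ninths, inflate_collapse]

theorem inflate_pos {s : ℝ} (h : 0 ≤ s) : 0 < inflate s := by
  have := strictMono_inflate.monotone h
  rw [inflate_zero] at this; linarith

theorem deriv_collapse_mul_deriv_inflate (s : ℝ) :
    deriv collapse (inflate s) * deriv inflate s = 1 := by
  have hcomp := (differentiable_collapse (inflate s)).hasDerivAt.comp s
    (contDiff_inflate.differentiable (by simp) s).hasDerivAt
  rw [show collapse ∘ inflate = id from funext collapse_inflate] at hcomp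
  exact hcomp.unique (hasDerivAt_id s)

/-! ### Integrals depending smoothly on a parameter -/

section ParametricIntegral

universe u

variable {E F : Type u} [NormedAddCommGroup E] [NormedSpace ℝ E] [ProperSpace E]
  [NormedAddCommGroup F] [NormedSpace ℝ F]

theorem hasFDerivAt_integral_of_contDiff {h : E × ℝ → F} (hh : ContDiff ℝ 1 h) (a b : ℝ) (z : E) :
    HasFDerivAt (fun z ↦ ∫ t in a..b, h (z, t))
      (∫ t in a..b, (fderiv ℝ h (z, t)).comp (ContinuousLinearMap.inl ℝ E ℝ)) z := by
  have hderiv : Continuous fun p : E × ℝ ↦ (fderiv ℝ h p).comp (ContinuousLinearMap.inl ℝ E ℝ) :=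
    (hh.continuous_fderiv (by simp)).clm_comp continuous_const
  have hslice (x : E) : Continuous fun t : ℝ ↦ (x, t) := by fun_prop
  obtain ⟨C, hC⟩ := ((isCompact_closedBall z 1).prod
    (isCompact_uIcc (a := a) (b := b))).exists_bound_of_continuousOn hderiv.continuousOn
  refine intervalIntegral.hasFDerivAt_integral_of_dominated_of_fderiv_le (bound := fun _ ↦ C)
    (F' := fun z t ↦ (fderiv ℝ h (z, t)).comp (ContinuousLinearMap.inl ℝ E ℝ))
    (Metric.ball_mem_nhds z one_pos) ?_ ?_ ?_ ?_ intervalIntegrable_const ?_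
  · exact .of_forall fun x ↦ (hh.continuous.comp (hslice x)).aestronglyMeasurable
  · exact (hh.continuous.comp (hslice z)).intervalIntegrable _ _
  · exact (hderiv.comp (hslice z)).aestronglyMeasurable
  · exact .of_forall fun t ht x hx ↦
      hC (x, t) ⟨Metric.ball_subset_closedBall hx, Set.uIoc_subset_uIcc ht⟩
  · exact .of_forall fun t _ x _ ↦
      (hh.differentiable (by simp) (x, t)).hasFDerivAt.comp x (hasFDerivAt_prodMk_left x t)

theorem contDiff_integral {h : E × ℝ → F} (hh : ContDiff ℝ ∞ h) (a b : ℝ) :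
    ContDiff ℝ ∞ fun z ↦ ∫ t in a..b, h (z, t) := by
  rw [contDiff_infty]
  intro n
  induction n generalizing F with
  | zero =>
    exact contDiff_zero.2 (continuous_iff_continuousAt.2 fun z ↦
      (hasFDerivAt_integral_of_contDiff (hh.of_le (by simp)) a b z).continuousAt)
  | succ n ih =>
    rw [Nat.cast_succ, contDiff_succ_iff_hasFDerivAt]
    exact ⟨_, ih ((hh.fderiv_right (by simp)).clm_comp contDiff_const),
      hasFDerivAt_integral_of_contDiff (hh.of_le (by simp)) a b⟩

theorem contDiff_primitive {g : E × ℝ → F} (hg : ContDiff ℝ ∞ g) :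
    ContDiff ℝ ∞ fun z : E × ℝ ↦ ∫ s in (0 : ℝ)..z.2, g (z.1, s) := by
  have hrescale : (fun z : E × ℝ ↦ ∫ s in (0 : ℝ)..z.2, g (z.1, s))
      = fun z ↦ z.2 • ∫ t in (0 : ℝ)..1, g (z.1, z.2 * t) := by
    funext z
    simpa using (intervalIntegral.smul_integral_comp_mul_left (a := 0) (b := 1)
      (fun s ↦ g (z.1, s)) z.2).symm
  rw [hrescale]
  exact contDiff_snd.smul
    (contDiff_integral (h := fun p : (E × ℝ) × ℝ ↦ g (p.1.1, p.1.2 * p.2))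
      (hg.comp (by fun_prop)) 0 1)

end ParametricIntegral

/-! ### Bilinear forms pulled back by derivatives -/

section BilinForm

variable {R M N : Type*} [CommRing R] [AddCommGroup M] [Module R M] [AddCommGroup N] [Module R N]

theorem injective_of_separatingLeft {α : LinearMap.BilinForm R M} {β : LinearMap.BilinForm R N}
    {f : M →ₗ[R] N} (hf : ∀ u v, β (f u) (f v) = α u v) (hα : α.SeparatingLeft) :
    Function.Injective f := by
  rw [injective_iff_map_eq_zero]
  intro u hu
  refine hα u fun v ↦ ?_
  rw [← hf, hu, map_zero, LinearMap.zero_apply]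

/-- The sum of the pullbacks of `α` and `β` to the product. -/
def prodForm (α : LinearMap.BilinForm R M) (β : LinearMap.BilinForm R N) :
    LinearMap.BilinForm R (M × N) :=
  α.compl₁₂ (LinearMap.fst R M N) (LinearMap.fst R M N)
    + β.compl₁₂ (LinearMap.snd R M N) (LinearMap.snd R M N)

theorem prodForm_apply (α : LinearMap.BilinForm R M) (β : LinearMap.BilinForm R N) (u v : M × N) :
    prodForm α β u v = α u.1 v.1 + β u.2 v.2 := rfl

theorem separatingLeft_prodForm {α : LinearMap.BilinForm R M} {β : LinearMap.BilinForm R N}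
    (hα : α.SeparatingLeft) (hβ : β.SeparatingLeft) : (prodForm α β).SeparatingLeft := by
  intro u hu
  refine Prod.ext (hα _ fun v ↦ ?_) (hβ _ fun v ↦ ?_)
  · simpa [prodForm_apply] using hu (v, 0)
  · simpa [prodForm_apply] using hu (0, v)

theorem separatingLeft_smul [NoZeroDivisors R] {α : LinearMap.BilinForm R M}
    (hα : α.SeparatingLeft) {c : R} (hc : c ≠ 0) : (c • α).SeparatingLeft := fun u hu ↦
  hα u fun v ↦ (mul_eq_zero.1 (hu v)).resolve_left hc

end BilinForm

section Pullback

variable {𝕜 E F G H : Type*} [NontriviallyNormedField 𝕜] [NormedAddCommGroup E] [NormedSpace 𝕜 E]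
  [NormedAddCommGroup F] [NormedSpace 𝕜 F] [NormedAddCommGroup G] [NormedSpace 𝕜 G]
  [NormedAddCommGroup H] [NormedSpace 𝕜 H]

/-- At `x`, the map `f` is differentiable and pulls the bilinear form `β` back to `α`. -/
def HasPullbackAt (f : E → F) (β : LinearMap.BilinForm 𝕜 F) (α : LinearMap.BilinForm 𝕜 E)
    (x : E) : Prop :=
  ∃ f' : E →L[𝕜] F, HasFDerivAt f f' x ∧ ∀ u v, β (f' u) (f' v) = α u v

namespace HasPullbackAt

variable {f : E → F} {α : LinearMap.BilinForm 𝕜 E} {β : LinearMap.BilinForm 𝕜 F} {x : E}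

theorem comp {g : F → G} {γ : LinearMap.BilinForm 𝕜 G} (hg : HasPullbackAt g γ β (f x))
    (hf : HasPullbackAt f β α x) : HasPullbackAt (g ∘ f) γ α x := by
  obtain ⟨f', hf, hf'⟩ := hf
  obtain ⟨g', hg, hg'⟩ := hg
  exact ⟨_, hg.comp x hf, fun u v ↦ by simp only [ContinuousLinearMap.comp_apply, hg', hf']⟩

theorem prodMap {g : G → H} {γ : LinearMap.BilinForm 𝕜 G} {δ : LinearMap.BilinForm 𝕜 H}
    {p : E × G} (hf : HasPullbackAt f β α p.1) (hg : HasPullbackAt g δ γ p.2) :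
    HasPullbackAt (Prod.map f g) (prodForm β δ) (prodForm α γ) p := by
  obtain ⟨f', hf, hf'⟩ := hf
  obtain ⟨g', hg, hg'⟩ := hg
  exact ⟨_, hf.prodMap p hg, fun u v ↦ by
    simp only [prodForm_apply, ContinuousLinearMap.coe_prodMap', Prod.map_fst, Prod.map_snd,
      hf', hg']⟩

theorem congr_of_eventuallyEq {f₁ : E → F} (hf : HasPullbackAt f β α x) (h : f₁ =ᶠ[nhds x] f) :
    HasPullbackAt f₁ β α x := by
  obtain ⟨f', hf, hf'⟩ := hf
  exact ⟨f', hf.congr_of_eventuallyEq h, hf'⟩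

theorem smul (hf : HasPullbackAt f β α x) (c : 𝕜) : HasPullbackAt f (c • β) (c • α) x := by
  obtain ⟨f', hf, hf'⟩ := hf
  exact ⟨f', hf, fun u v ↦ by simp only [LinearMap.smul_apply, hf']⟩

theorem id_add_const (α : LinearMap.BilinForm 𝕜 E) (c x : E) :
    HasPullbackAt (fun z ↦ z + c) α α x :=
  ⟨_, (hasFDerivAt_id x).add_const c, fun _ _ ↦ rfl⟩

end HasPullbackAt

end Pullback

theorem HasPullbackAt.map_nhds_eq {𝕜 E : Type*} [RCLike 𝕜] [NormedAddCommGroup E]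
    [NormedSpace 𝕜 E] [FiniteDimensional 𝕜 E] {f : E → E} {α β : LinearMap.BilinForm 𝕜 E} {x : E}
    {n : WithTop ℕ∞} (hf : HasPullbackAt f β α x) (hα : α.SeparatingLeft)
    (hc : ContDiffAt 𝕜 n f x) (hn : n ≠ 0) : Filter.map f (nhds x) = nhds (f x) := by
  have := FiniteDimensional.complete 𝕜 E
  obtain ⟨f', hf, hf'⟩ := hf
  have hsurj : Function.Surjective (f' : E →ₗ[𝕜] E) :=
    LinearMap.injective_iff_surjective.1 (injective_of_separatingLeft hf' hα)
  exact (hc.hasStrictFDerivAt' hf hn).map_nhds_eq_of_surj (LinearMap.range_eq_top.2 hsurj)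

/-- The area form of the plane, as a bilinear form. -/
def area : LinearMap.BilinForm ℝ (ℝ × ℝ) :=
  LinearMap.mk₂ ℝ (fun u v ↦ u.1 * v.2 - u.2 * v.1)
    (fun _ _ _ ↦ by simp only [Prod.fst_add, Prod.snd_add]; ring)
    (fun _ _ _ ↦ by simp only [Prod.smul_fst, Prod.smul_snd, smul_eq_mul]; ring)
    (fun _ _ _ ↦ by simp only [Prod.fst_add, Prod.snd_add]; ring)
    (fun _ _ _ ↦ by simp only [Prod.smul_fst, Prod.smul_snd, smul_eq_mul]; ring)

theorem area_apply (u v : ℝ × ℝ) : area u v = u.1 * v.2 - u.2 * v.1 := rfl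

theorem separatingLeft_area : area.SeparatingLeft := by
  intro u hu
  refine Prod.ext ?_ ?_
  · simpa [area_apply] using hu (0, 1)
  · simpa [area_apply] using hu (1, 0)

/-! ### Opening the lattice points to holes -/

/-- The squared Euclidean norm; the norm Mathlib puts on `ℝ × ℝ` is the supremum norm. -/
def normSq (w : ℝ × ℝ) : ℝ := w.1 ^ 2 + w.2 ^ 2

theorem normSq_smul (a : ℝ) (w : ℝ × ℝ) : normSq (a • w) = a ^ 2 * normSq w := by
  simp only [normSq, Prod.smul_fst, Prod.smul_snd, smul_eq_mul]; ring

theorem normSq_pos {w : ℝ × ℝ} (hw : w ≠ 0) : 0 < normSq w := by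
  refine (add_nonneg (sq_nonneg w.1) (sq_nonneg w.2)).lt_of_ne' fun h ↦ hw ?_
  rw [add_eq_zero_iff_of_nonneg (sq_nonneg _) (sq_nonneg _), sq_eq_zero_iff, sq_eq_zero_iff] at h
  exact Prod.ext h.1 h.2

theorem contDiff_normSq : ContDiff ℝ ∞ normSq := by unfold normSq; fun_prop

theorem abs_lt_half_of_normSq_lt {w : ℝ × ℝ} (h : normSq w < 1 / 4) :
    |w.1| < 1 / 2 ∧ |w.2| < 1 / 2 := by
  unfold normSq at h
  constructor <;> apply abs_lt_of_sq_lt_sq _ (by norm_num) <;>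
    nlinarith [sq_nonneg w.1, sq_nonneg w.2]

theorem hasPullbackAt_radial {g : ℝ → ℝ} {g' : ℝ} {w : ℝ × ℝ} (hg : HasDerivAt g g' (normSq w)) :
    HasPullbackAt (fun w ↦ g (normSq w) • w) area
      ((g (normSq w) ^ 2 + 2 * normSq w * g (normSq w) * g') • area) w := by
  have hnorm : HasFDerivAt normSq _ w :=
    ((hasFDerivAt_fst (𝕜 := ℝ)).pow 2).add ((hasFDerivAt_snd (𝕜 := ℝ)).pow 2)
  refine ⟨_, (hg.comp_hasFDerivAt w hnorm).smul (hasFDerivAt_id w), fun u v ↦ ?_⟩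
  simp only [Function.comp_apply, normSq, Nat.add_one_sub_one, pow_one, nsmul_eq_mul,
    Nat.cast_ofNat, smul_add, add_apply, smul_apply, ContinuousLinearMap.id_apply,
    ContinuousLinearMap.smulRight_apply, ContinuousLinearMap.coe_fst', smul_eq_mul,
    ContinuousLinearMap.coe_snd', map_add, map_smul, LinearMap.add_apply, LinearMap.smul_apply,
    area_apply]
  ring

/-- A function on the plane that is invariant under translations by `ℤ²`. -/
def IsDoublyPeriodic {X : Type*} (f : ℝ × ℝ → X) : Prop :=
  ∀ (z : ℝ × ℝ) (m n : ℤ), f (z + ((m : ℝ), (n : ℝ))) = f z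

/-- A point of `ℤ²` nearest to `z`. -/
def nearestLatticePoint (z : ℝ × ℝ) : ℝ × ℝ := (round z.1, round z.2)

/-- The difference between `z` and a nearest lattice point. -/
def residue (z : ℝ × ℝ) : ℝ × ℝ := z - nearestLatticePoint z

theorem nearestLatticePoint_add_residue (z : ℝ × ℝ) : nearestLatticePoint z + residue z = z :=
  add_sub_cancel _ _

theorem isDoublyPeriodic_residue : IsDoublyPeriodic residue := fun z m n ↦ by
  simp [residue, nearestLatticePoint, Prod.ext_iff]

theorem residue_swap (x y : ℝ) : residue (y, x) = (residue (x, y)).swap := rfl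

theorem nearestLatticePoint_add_of_abs_lt (z : ℝ × ℝ) {w : ℝ × ℝ} (h₁ : |w.1| < 1 / 2)
    (h₂ : |w.2| < 1 / 2) :
    nearestLatticePoint (nearestLatticePoint z + w) = nearestLatticePoint z := by
  rw [abs_lt] at h₁ h₂
  have hround₁ : round ((round z.1 : ℝ) + w.1) = round z.1 := by
    rw [round_eq_iff]; constructor <;> linarith
  have hround₂ : round ((round z.2 : ℝ) + w.2) = round z.2 := by
    rw [round_eq_iff]; constructor <;> linarith
  simp only [nearestLatticePoint, Prod.fst_add, Prod.snd_add, hround₁, hround₂]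

theorem nearestLatticePoint_eventuallyEq {z : ℝ × ℝ} (h : normSq (residue z) < 1 / 4) :
    ∀ᶠ y in nhds z, nearestLatticePoint y = nearestLatticePoint z := by
  have hc : ContinuousAt (fun y ↦ y - nearestLatticePoint z) z := by fun_prop
  have ho : IsOpen {w : ℝ × ℝ | |w.1| < 1 / 2 ∧ |w.2| < 1 / 2} :=
    (isOpen_lt continuous_fst.abs continuous_const).inter
      (isOpen_lt continuous_snd.abs continuous_const)
  filter_upwards [hc.eventually (ho.mem_nhds (abs_lt_half_of_normSq_lt h))] with y hy
  simpa using nearestLatticePoint_add_of_abs_lt z hy.1 hy.2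

theorem residue_eventuallyEq {z : ℝ × ℝ} (h : normSq (residue z) < 1 / 4) :
    ∀ᶠ y in nhds z, residue y = y - nearestLatticePoint z := by
  filter_upwards [nearestLatticePoint_eventuallyEq h] with y hy
  rw [residue, hy]

theorem continuous_normSq_residue : Continuous fun z ↦ normSq (residue z) := by
  have hnorm : (fun z ↦ normSq (residue z)) =
      fun z : ℝ × ℝ ↦ ‖(z.1 : UnitAddCircle)‖ ^ 2 + ‖(z.2 : UnitAddCircle)‖ ^ 2 := by
    funext z
    simp only [normSq, residue, nearestLatticePoint, Prod.fst_sub, Prod.snd_sub,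
      UnitAddCircle.norm_eq, sq_abs]
  have hc : Continuous fun x : ℝ ↦ (x : UnitAddCircle) := AddCircle.continuous_mk' 1
  rw [hnorm]
  exact ((hc.comp continuous_fst).norm.pow 2).add ((hc.comp continuous_snd).norm.pow 2)

theorem eventually_lt_normSq_residue {r : ℝ} {z : ℝ × ℝ} (h : r < normSq (residue z)) :
    ∀ᶠ y in nhds z, r < normSq (residue y) :=
  continuous_normSq_residue.continuousAt.eventually (lt_mem_nhds h)

/-- The discs of squared radius `r < 1 / 4` around the lattice points are disjoint, so near each
point the periodization of `g` is either a translate of `g` or zero. -/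
theorem contDiffAt_comp_residue {F : Type*} [NormedAddCommGroup F] [NormedSpace ℝ F]
    {g : ℝ × ℝ → F} {z : ℝ × ℝ} {r : ℝ} (hr : r < 1 / 4) (hg : ContDiffAt ℝ ∞ g (residue z))
    (hsupp : ∀ w, r < normSq w → g w = 0) : ContDiffAt ℝ ∞ (fun z ↦ g (residue z)) z := by
  rcases lt_or_ge (normSq (residue z)) (1 / 4) with h | h
  · have htranslate : ContDiffAt ℝ ∞ (fun y ↦ g (y - nearestLatticePoint z)) z :=
      ContDiffAt.comp z hg (contDiffAt_id.sub contDiffAt_const)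
    refine htranslate.congr_of_eventuallyEq ?_
    filter_upwards [residue_eventuallyEq h] with y hy
    rw [hy]
  · refine (contDiffAt_const (c := (0 : F))).congr_of_eventuallyEq ?_
    filter_upwards [eventually_lt_normSq_residue (hr.trans_le h)] with y hy
    exact hsupp _ hy

/-- The complement of the lattice `ℤ²` in the plane. -/
def puncturedPlane : Set (ℝ × ℝ) := {z | residue z ≠ 0}

theorem add_mem_puncturedPlane {z : ℝ × ℝ} (hz : z ∈ puncturedPlane) (m n : ℤ) :
    z + ((m : ℝ), (n : ℝ)) ∈ puncturedPlane := by
  rwa [puncturedPlane, Set.mem_ofPred_eq, isDoublyPeriodic_residue]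

theorem normSq_residue_pos {z : ℝ × ℝ} (hz : z ∈ puncturedPlane) : 0 < normSq (residue z) :=
  normSq_pos hz

/-- The factor by which the radial map with `inflate` as its action on squared radii multiplies
vectors of squared length `s`. -/
def inflateFactor (s : ℝ) : ℝ := √(inflate s / s)

theorem inflateFactor_sq_mul {s : ℝ} (hs : 0 < s) : inflateFactor s ^ 2 * s = inflate s := by
  rw [inflateFactor, Real.sq_sqrt (div_nonneg (inflate_pos hs.le).le hs.le),
    div_mul_cancel₀ _ hs.ne']

theorem inflateFactor_pos {s : ℝ} (hs : 0 < s) : 0 < inflateFactor s :=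
  Real.sqrt_pos.2 (div_pos (inflate_pos hs.le) hs)

theorem contDiffAt_inflateFactor {s : ℝ} (hs : 0 < s) : ContDiffAt ℝ ∞ inflateFactor s :=
  (contDiff_inflate.contDiffAt.div contDiffAt_id hs.ne').sqrt (div_pos (inflate_pos hs.le) hs).ne'

theorem inflateFactor_of_ge {s : ℝ} (hs : 17 / 72 ≤ s) : inflateFactor s = 1 := by
  rw [inflateFactor, inflate_of_ge hs, div_self (by linarith), Real.sqrt_one]

theorem deriv_inflate_eq {s : ℝ} (hs : 0 < s) :
    deriv inflate s
      = inflateFactor s ^ 2 + 2 * s * inflateFactor s * deriv inflateFactor s := by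
  have hfactor : HasDerivAt inflateFactor (deriv inflateFactor s) s :=
    ((contDiffAt_inflateFactor hs).differentiableAt (by simp)).hasDerivAt
  have heq : inflate =ᶠ[nhds s] fun t ↦ inflateFactor t ^ 2 * t := by
    filter_upwards [lt_mem_nhds hs] with t ht
    exact (inflateFactor_sq_mul ht).symm
  rw [heq.deriv_eq, ((hfactor.fun_pow 2).fun_mul (hasDerivAt_id' s)).deriv]
  simp only [Nat.add_one_sub_one, pow_one, Nat.cast_ofNat]
  ring

/-- The map of the plane that opens every lattice point to a disc of radius `√2 / 3`. -/
def openPunctures (z : ℝ × ℝ) : ℝ × ℝ :=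
  nearestLatticePoint z + inflateFactor (normSq (residue z)) • residue z

theorem openPunctures_eq_add (z : ℝ × ℝ) :
    openPunctures z = z + (inflateFactor (normSq (residue z)) - 1) • residue z := by
  rw [sub_smul, one_smul, openPunctures]
  conv_rhs => enter [1]; rw [← nearestLatticePoint_add_residue z]
  abel

theorem openPunctures_of_ge {z : ℝ × ℝ} (h : 17 / 72 ≤ normSq (residue z)) :
    openPunctures z = z := by
  rw [openPunctures, inflateFactor_of_ge h, one_smul, nearestLatticePoint_add_residue]

theorem openPunctures_add_int (z : ℝ × ℝ) (m n : ℤ) :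
    openPunctures (z + ((m : ℝ), (n : ℝ))) = openPunctures z + ((m : ℝ), (n : ℝ)) := by
  rw [openPunctures_eq_add, openPunctures_eq_add, isDoublyPeriodic_residue]; abel

theorem nearestLatticePoint_openPunctures {z : ℝ × ℝ} (hz : z ∈ puncturedPlane) :
    nearestLatticePoint (openPunctures z) = nearestLatticePoint z := by
  rcases le_or_gt (17 / 72) (normSq (residue z)) with hge | hlt
  · rw [openPunctures_of_ge hge]
  · have hsmall : normSq (inflateFactor (normSq (residue z)) • residue z) < 1 / 4 := by
      rw [normSq_smul, inflateFactor_sq_mul (normSq_residue_pos hz)]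
      refine (strictMono_inflate hlt).trans ?_
      rw [inflate_of_ge le_rfl]
      norm_num
    obtain ⟨h₁, h₂⟩ := abs_lt_half_of_normSq_lt hsmall
    exact nearestLatticePoint_add_of_abs_lt z h₁ h₂

theorem residue_openPunctures {z : ℝ × ℝ} (hz : z ∈ puncturedPlane) :
    residue (openPunctures z) = inflateFactor (normSq (residue z)) • residue z := by
  rw [residue, nearestLatticePoint_openPunctures hz, openPunctures, add_sub_cancel_left]

theorem normSq_residue_openPunctures {z : ℝ × ℝ} (hz : z ∈ puncturedPlane) :
    normSq (residue (openPunctures z)) = inflate (normSq (residue z)) := by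
  rw [residue_openPunctures hz, normSq_smul, inflateFactor_sq_mul (normSq_residue_pos hz)]

theorem two_ninths_lt_normSq_residue_openPunctures {z : ℝ × ℝ} (hz : z ∈ puncturedPlane) :
    2 / 9 < normSq (residue (openPunctures z)) := by
  rw [normSq_residue_openPunctures hz, ← inflate_zero]
  exact strictMono_inflate (normSq_residue_pos hz)

theorem injOn_openPunctures : puncturedPlane.InjOn openPunctures := by
  intro z hz z' hz' heq
  have hcenter : nearestLatticePoint z = nearestLatticePoint z' := by
    rw [← nearestLatticePoint_openPunctures hz, ← nearestLatticePoint_openPunctures hz', heq]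
  have hnorm : normSq (residue z) = normSq (residue z') :=
    strictMono_inflate.injective <| by
      rw [← normSq_residue_openPunctures hz, ← normSq_residue_openPunctures hz', heq]
  have hresidue : residue z = residue z' := by
    refine smul_right_injective _ (inflateFactor_pos (normSq_residue_pos hz')).ne' ?_
    simp only
    rw [← residue_openPunctures hz', ← heq, residue_openPunctures hz, hnorm]
  rw [← nearestLatticePoint_add_residue z, hcenter, hresidue, nearestLatticePoint_add_residue]

theorem contDiffAt_openPunctures {z : ℝ × ℝ} (hz : z ∈ puncturedPlane) :
    ContDiffAt ℝ ∞ openPunctures z := by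
  rw [funext openPunctures_eq_add]
  refine contDiffAt_id.add (contDiffAt_comp_residue (r := 17 / 72) (by norm_num)
    (g := fun w ↦ (inflateFactor (normSq w) - 1) • w) ?_ fun w hw ↦ ?_)
  · exact (((contDiffAt_inflateFactor (normSq_residue_pos hz)).comp _
      contDiff_normSq.contDiffAt).sub contDiffAt_const).smul contDiffAt_id
  · rw [inflateFactor_of_ge hw.le, sub_self, zero_smul]

theorem hasPullbackAt_openPunctures_of_lt {z : ℝ × ℝ} (hz : z ∈ puncturedPlane)
    (h : normSq (residue z) < 1 / 4) :
    HasPullbackAt openPunctures area (deriv inflate (normSq (residue z)) • area) z := by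
  have hpos := normSq_residue_pos hz
  have hradial := hasPullbackAt_radial (w := residue z)
    ((contDiffAt_inflateFactor hpos).differentiableAt (by simp)).hasDerivAt
  rw [← deriv_inflate_eq hpos] at hradial
  have hshift := HasPullbackAt.id_add_const
    (deriv inflate (normSq (residue z)) • area) (-nearestLatticePoint z) z
  refine ((HasPullbackAt.id_add_const area (nearestLatticePoint z) _).comp
    (HasPullbackAt.comp (f := fun y ↦ y + -nearestLatticePoint z) hradial hshift)
    ).congr_of_eventuallyEq ?_
  filter_upwards [residue_eventuallyEq h, nearestLatticePoint_eventuallyEq h] with y hy hy'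
  rw [openPunctures, hy, hy', add_comm, sub_eq_add_neg]
  rfl

theorem hasPullbackAt_openPunctures_of_gt {z : ℝ × ℝ} (h : 17 / 72 < normSq (residue z)) :
    HasPullbackAt openPunctures area (deriv inflate (normSq (residue z)) • area) z := by
  have hid : openPunctures =ᶠ[nhds z] fun y ↦ y + 0 := by
    filter_upwards [eventually_lt_normSq_residue h] with y hy
    rw [openPunctures_of_ge hy.le, add_zero]
  have hderiv : deriv inflate (normSq (residue z)) = 1 := by
    have hprod := deriv_collapse_mul_deriv_inflate (normSq (residue z))
    rwa [inflate_of_ge h.le, deriv_collapse_of_gt h, one_mul] at hprod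
  rw [hderiv, one_smul]
  exact (HasPullbackAt.id_add_const area 0 z).congr_of_eventuallyEq hid

theorem hasPullbackAt_openPunctures {z : ℝ × ℝ} (hz : z ∈ puncturedPlane) :
    HasPullbackAt openPunctures area (deriv inflate (normSq (residue z)) • area) z := by
  rcases lt_or_ge (normSq (residue z)) (1 / 4) with h | h
  · exact hasPullbackAt_openPunctures_of_lt hz h
  · exact hasPullbackAt_openPunctures_of_gt (by linarith)

/-- The density, with respect to the standard one, of the area form that `openPunctures` transports
from the punctured plane to the plane with holes. It extends smoothly over the holes. -/
def density (z : ℝ × ℝ) : ℝ := deriv collapse (normSq (residue z))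

theorem contDiff_density : ContDiff ℝ ∞ density := by
  have hsub : ContDiff ℝ ∞ fun z ↦ deriv collapse (normSq (residue z)) - 1 := by
    refine contDiff_iff_contDiffAt.2 fun z ↦ contDiffAt_comp_residue (r := 17 / 72) (by norm_num)
      (g := fun w ↦ deriv collapse (normSq w) - 1) ?_ fun w hw ↦ ?_
    · exact (((contDiff_infty_iff_deriv.1 contDiff_collapse).2.comp contDiff_normSq).sub
        contDiff_const).contDiffAt
    · rw [deriv_collapse_of_gt hw, sub_self]
  rw [show density = fun z ↦ deriv collapse (normSq (residue z)) - 1 + 1 from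
    funext fun z ↦ (sub_add_cancel _ _).symm]
  exact hsub.add contDiff_const

theorem density_pos (z : ℝ × ℝ) : 0 < density z := deriv_collapse_pos _

theorem density_openPunctures_mul {z : ℝ × ℝ} (hz : z ∈ puncturedPlane) :
    density (openPunctures z) * deriv inflate (normSq (residue z)) = 1 := by
  rw [density, normSq_residue_openPunctures hz, deriv_collapse_mul_deriv_inflate]

theorem isDoublyPeriodic_density : IsDoublyPeriodic density := fun z m n ↦ by
  rw [density, density, isDoublyPeriodic_residue]

theorem density_swap (x y : ℝ) : density (y, x) = density (x, y) := by
  rw [density, density, residue_swap, normSq, normSq, Prod.fst_swap, Prod.snd_swap, add_comm]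

/-! ### Straightening the density -/

/-- The linear coordinates `x + y` and `y - x`. -/
def slant (z : ℝ × ℝ) : ℝ × ℝ := (z.1 + z.2, z.2 - z.1)

theorem contDiff_slant : ContDiff ℝ ∞ slant := by unfold slant; fun_prop

theorem hasPullbackAt_slant (z : ℝ × ℝ) : HasPullbackAt slant area ((2 : ℝ) • area) z := by
  refine ⟨_, (hasFDerivAt_fst.add hasFDerivAt_snd).prodMk (hasFDerivAt_snd.sub hasFDerivAt_fst),
    fun u v ↦ ?_⟩
  simp only [ContinuousLinearMap.prod_apply, add_apply, ContinuousLinearMap.coe_fst',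
    ContinuousLinearMap.coe_snd', sub_apply, area_apply, LinearMap.smul_apply, smul_eq_mul]
  ring

/-- `density` in the coordinates given by `slant`. -/
def slantDensity (w : ℝ × ℝ) : ℝ := density ((w.1 - w.2) / 2, (w.1 + w.2) / 2)

theorem slantDensity_slant (z : ℝ × ℝ) : slantDensity (slant z) = density z := by
  rw [slantDensity]
  congr 1
  ext <;> simp only [slant] <;> ring

theorem contDiff_slantDensity : ContDiff ℝ ∞ slantDensity := contDiff_density.comp (by fun_prop)

theorem slantDensity_pos (w : ℝ × ℝ) : 0 < slantDensity w := density_pos _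

theorem slantDensity_add_int (p s : ℝ) (m n : ℤ) :
    slantDensity (p + (m + n), s + (n - m)) = slantDensity (p, s) := by
  refine (congrArg density ?_).trans
    (isDoublyPeriodic_density ((p - s) / 2, (p + s) / 2) m n)
  ext <;> simp only [Prod.fst_add, Prod.snd_add] <;> ring

theorem slantDensity_add_one (p s : ℝ) : slantDensity (p + 1, s + 1) = slantDensity (p, s) := by
  simpa using slantDensity_add_int p s 0 1

theorem slantDensity_add_two (p s : ℝ) : slantDensity (p + 2, s) = slantDensity (p, s) := by
  simpa [one_add_one_eq_two] using slantDensity_add_int p s 1 1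

theorem slantDensity_sub_int (w : ℝ × ℝ) (n : ℤ) :
    slantDensity (w - ((n : ℝ), (n : ℝ))) = slantDensity w := by
  simpa [← sub_eq_add_neg, Prod.sub_def] using slantDensity_add_int w.1 w.2 0 (-n)

theorem slantDensity_neg (p s : ℝ) : slantDensity (p, -s) = slantDensity (p, s) := by
  rw [slantDensity, slantDensity, density_swap, sub_neg_eq_add, ← sub_eq_add_neg]

/-- The integral of the density along a vertical segment. -/
def height (w : ℝ × ℝ) : ℝ := ∫ s in (0 : ℝ)..w.2, slantDensity (w.1, s)

/-- The integral of the density over a vertical period. -/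
def totalHeight (q : ℝ) : ℝ := height (q, 1)

theorem contDiff_height : ContDiff ℝ ∞ height := contDiff_primitive contDiff_slantDensity

theorem contDiff_totalHeight : ContDiff ℝ ∞ totalHeight := contDiff_height.comp (by fun_prop)

theorem continuous_slantDensity_right (q : ℝ) : Continuous fun s ↦ slantDensity (q, s) :=
  contDiff_slantDensity.continuous.comp (by fun_prop)

theorem intervalIntegrable_slantDensity (q a b : ℝ) :
    IntervalIntegrable (fun s ↦ slantDensity (q, s)) MeasureTheory.volume a b :=
  (continuous_slantDensity_right q).intervalIntegrable a b

theorem hasDerivAt_height (q v : ℝ) :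
    HasDerivAt (fun v ↦ height (q, v)) (slantDensity (q, v)) v :=
  intervalIntegral.integral_hasDerivAt_right (intervalIntegrable_slantDensity q 0 v)
    ((continuous_slantDensity_right q).stronglyMeasurableAtFilter _ _)
    (continuous_slantDensity_right q).continuousAt

theorem strictMono_height (q : ℝ) : StrictMono fun v ↦ height (q, v) :=
  strictMono_of_deriv_pos fun v ↦ by
    rw [(hasDerivAt_height q v).deriv]; exact slantDensity_pos _

theorem height_zero (q : ℝ) : height (q, 0) = 0 := intervalIntegral.integral_same

theorem height_nonneg (q : ℝ) {v : ℝ} (hv : 0 ≤ v) : 0 ≤ height (q, v) := by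
  rw [← height_zero q]; exact (strictMono_height q).monotone hv

theorem height_lt_totalHeight (q : ℝ) {v : ℝ} (hv : v < 1) : height (q, v) < totalHeight q :=
  strictMono_height q hv

theorem totalHeight_pos (q : ℝ) : 0 < totalHeight q := by
  rw [← height_zero q]; exact height_lt_totalHeight q zero_lt_one

theorem height_neg_one (q : ℝ) : height (q, -1) = -totalHeight q := by
  have hneg := intervalIntegral.integral_comp_neg (a := 0) (b := 1) fun s ↦ slantDensity (q, s)
  simp only [slantDensity_neg, neg_zero] at hneg
  rw [totalHeight, height, height, hneg, intervalIntegral.integral_symm]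

theorem height_add_one (q v : ℝ) : height (q + 1, v + 1) = height (q, v) + totalHeight q := by
  have hshift := intervalIntegral.integral_comp_add_right (a := -1) (b := v)
    (fun s ↦ slantDensity (q + 1, s)) 1
  have hsplit := intervalIntegral.integral_add_adjacent_intervals
    (intervalIntegrable_slantDensity q (-1) 0) (intervalIntegrable_slantDensity q 0 v)
  have hneg := height_neg_one q
  rw [height, intervalIntegral.integral_symm] at hneg
  simp only [slantDensity_add_one, neg_add_cancel] at hshift
  rw [height, height, ← hshift, ← hsplit]
  linarith

theorem height_add_two (q v : ℝ) : height (q + 2, v) = height (q, v) := by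
  simp only [height, slantDensity_add_two]

theorem periodic_totalHeight : Function.Periodic totalHeight 1 := fun q ↦ by
  have h := height_add_one q 0
  rwa [height_zero, zero_add, zero_add] at h

theorem exists_totalHeight_le : ∃ C, ∀ q, totalHeight q ≤ C := by
  obtain ⟨C, hC⟩ := isCompact_Icc (a := (0 : ℝ)) (b := 1) |>.exists_bound_of_continuousOn
    contDiff_totalHeight.continuous.continuousOn
  refine ⟨C, fun q ↦ ?_⟩
  obtain ⟨y, hy, hqy⟩ := periodic_totalHeight.exists_mem_Ico₀ zero_lt_one q
  rw [hqy]
  exact (Real.le_norm_self _).trans (hC y (Set.Ico_subset_Icc_self hy))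

theorem hasPullbackAt_height (w : ℝ × ℝ) :
    HasPullbackAt (fun w ↦ (w.1, height w)) area (slantDensity w • area) w := by
  have hheight : HasFDerivAt height (fderiv ℝ height w) w :=
    (contDiff_height.differentiable (by simp) w).hasFDerivAt
  refine ⟨_, hasFDerivAt_fst.prodMk hheight, fun u v ↦ ?_⟩
  have hvertical : fderiv ℝ height w (0, 1) = slantDensity w :=
    HasDerivAt.unique (HasFDerivAt.comp_hasDerivAt (f := fun v ↦ (w.1, v)) w.2 hheight
      ((hasDerivAt_const w.2 w.1).prodMk (hasDerivAt_id w.2))) (hasDerivAt_height w.1 w.2)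
  have happly : ∀ u : ℝ × ℝ, fderiv ℝ height w u
      = u.1 * fderiv ℝ height w (1, 0) + u.2 * slantDensity w := fun u ↦ by
    rw [← hvertical, ← smul_eq_mul, ← smul_eq_mul, ← map_smul, ← map_smul, ← map_add]
    simp
  simp only [area_apply, LinearMap.smul_apply, smul_eq_mul, ContinuousLinearMap.prod_apply,
    ContinuousLinearMap.coe_fst']
  rw [happly u, happly v]
  ring

/-! ### The torus as a strip -/

/-- The representative of `w` in the strip `ℝ × [0, 1)` modulo translation along the diagonal. -/
def toStrip (w : ℝ × ℝ) : ℝ × ℝ := (w.1 - ⌊w.2⌋, Int.fract w.2)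

/-- The coordinates of a point of the punctured plane on the strip `ℝ × [0, 1)`, once the punctures
are opened into holes. Modulo `2ℤ × {0}` they are coordinates on the torus. -/
def stripCoord (z : ℝ × ℝ) : ℝ × ℝ := toStrip (slant (openPunctures z))

theorem stripCoord_snd_mem_Ico (z : ℝ × ℝ) : (stripCoord z).2 ∈ Set.Ico (0 : ℝ) 1 :=
  ⟨Int.fract_nonneg _, Int.fract_lt_one _⟩

theorem slant_add_int (z : ℝ × ℝ) (m n : ℤ) :
    slant (z + ((m : ℝ), (n : ℝ))) = slant z + ((m : ℝ) + n, ((n - m : ℤ) : ℝ)) := by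
  ext <;> simp only [slant, Prod.fst_add, Prod.snd_add] <;> push_cast <;> ring

theorem stripCoord_add_int (z : ℝ × ℝ) (m n : ℤ) :
    stripCoord (z + ((m : ℝ), (n : ℝ))) = stripCoord z + (2 * (m : ℝ), 0) := by
  rw [stripCoord, openPunctures_add_int, slant_add_int, stripCoord, toStrip, toStrip]
  ext
  · simp only [Prod.fst_add, Prod.snd_add, Int.floor_add_intCast]
    push_cast
    ring
  · simp only [Prod.snd_add, Int.fract_add_intCast, add_zero]

theorem exists_int_of_stripCoord {z z' : ℝ × ℝ} (hz : z ∈ puncturedPlane)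
    (hz' : z' ∈ puncturedPlane) {k : ℤ} (h₁ : (stripCoord z').1 = (stripCoord z).1 + 2 * k)
    (h₂ : (stripCoord z').2 = (stripCoord z).2) : ∃ m n : ℤ, z' = z + ((m : ℝ), (n : ℝ)) := by
  simp only [stripCoord, toStrip, slant, Int.fract] at h₁ h₂
  set i := ⌊(openPunctures z).2 - (openPunctures z).1⌋
  set i' := ⌊(openPunctures z').2 - (openPunctures z').1⌋
  refine ⟨k, k + i' - i, injOn_openPunctures hz' (add_mem_puncturedPlane hz _ _) ?_⟩
  rw [openPunctures_add_int]
  ext <;> simp only [Prod.fst_add, Prod.snd_add] <;> push_cast <;> linarith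

theorem exists_abs_sub_odd_lt {a b : ℝ} {k : ℤ} (ha : |a| ≤ 1 / 2) (hb : |b| ≤ 1 / 2)
    (hk : b - a = k) (hab : 2 / 9 < a ^ 2 + b ^ 2) :
    ∃ j : ℤ, |a + b - k - (2 * j + 1)| < 1 / 3 := by
  rw [abs_le] at ha hb
  have hk₁ : (-1 : ℝ) ≤ k := by linarith
  have hk₂ : (k : ℝ) ≤ 1 := by linarith
  obtain rfl | rfl | rfl : k = -1 ∨ k = 0 ∨ k = 1 := by
    have : -1 ≤ k := by exact_mod_cast hk₁
    have : k ≤ 1 := by exact_mod_cast hk₂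
    lia
  all_goals push_cast at hk ⊢
  · exact ⟨0, by rw [abs_lt]; push_cast; constructor <;> linarith⟩
  · obtain rfl : b = a := by linarith
    have hlt : 1 / 3 < |b| := lt_of_pow_lt_pow_left₀ 2 (abs_nonneg b) (by rw [sq_abs]; linarith)
    rcases lt_abs.1 hlt with hpos | hneg
    · exact ⟨0, by rw [abs_lt]; push_cast; constructor <;> linarith⟩
    · exact ⟨-1, by rw [abs_lt]; push_cast; constructor <;> linarith⟩
  · exact ⟨-1, by rw [abs_lt]; push_cast; constructor <;> linarith⟩

/-- The holes have radius at least `√2 / 3`, so they cover the line `y = x` except near the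
midpoints of its lattice points. -/
theorem exists_abs_stripCoord_sub_odd_lt {z : ℝ × ℝ} (hz : z ∈ puncturedPlane)
    (hv : (stripCoord z).2 = 0) : ∃ j : ℤ, |(stripCoord z).1 - (2 * j + 1)| < 1 / 3 := by
  have hhole := two_ninths_lt_normSq_residue_openPunctures hz
  obtain ⟨x, y, hxy⟩ : ∃ x y, openPunctures z = (x, y) := ⟨_, _, rfl⟩
  simp only [stripCoord, toStrip, slant, Int.fract, hxy] at hhole hv ⊢
  set n := ⌊y - x⌋
  obtain ⟨j, hj⟩ := exists_abs_sub_odd_lt (k := n - round y + round x) (abs_sub_round x)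
    (abs_sub_round y) (by push_cast; linarith) hhole
  refine ⟨round x + j, ?_⟩
  convert hj using 2
  push_cast
  ring

theorem hasPullbackAt_height_slant {z : ℝ × ℝ} (hz : z ∈ puncturedPlane) (n : ℤ) :
    HasPullbackAt
      (fun z ↦ let w := slant (openPunctures z) - ((n : ℝ), (n : ℝ)); (w.1, height w))
      area ((2 : ℝ) • area) z := by
  set c := slantDensity (slant (openPunctures z) + -((n : ℝ), (n : ℝ)))
  set d := deriv inflate (normSq (residue z))
  have hslant := (hasPullbackAt_slant (openPunctures z)).comp
    ((hasPullbackAt_openPunctures hz).smul 2)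
  have hshift := HasPullbackAt.comp (f := slant ∘ openPunctures)
    ((HasPullbackAt.id_add_const area (-((n : ℝ), (n : ℝ))) _).smul c) (hslant.smul c)
  have hstrip := (hasPullbackAt_height _).comp hshift
  have hcd : c * d = 1 := by
    rw [← density_openPunctures_mul hz, ← slantDensity_slant, ← slantDensity_sub_int _ n,
      sub_eq_add_neg]
  rw [smul_comm (2 : ℝ), smul_smul, hcd, one_smul] at hstrip
  exact hstrip

/-! ### Symplectic polar coordinates and the disc -/

/-- Symplectic polar coordinates: the point with angle `w.1`, measured from the second axis, at
which the area of the disc through it is `2π * w.2`. -/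
def polar (w : ℝ × ℝ) : ℝ × ℝ := (√(2 * w.2) * Real.sin w.1, √(2 * w.2) * Real.cos w.1)

theorem polar_add_int_mul_two_pi (t s : ℝ) (k : ℤ) :
    polar (t + k * (2 * Real.pi), s) = polar (t, s) := by
  simp only [polar, Real.sin_add_int_mul_two_pi, Real.cos_add_int_mul_two_pi]

theorem normSq_polar (t : ℝ) {s : ℝ} (hs : 0 ≤ s) : normSq (polar (t, s)) = 2 * s := by
  have hsqrt := Real.sq_sqrt (show 0 ≤ 2 * s by linarith)
  simp only [normSq, polar, mul_pow, hsqrt]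
  linear_combination (2 * s) * Real.sin_sq_add_cos_sq t

theorem eq_of_polar_eq {t s t' s' : ℝ} (hs : 0 < s) (hs' : 0 < s')
    (h : polar (t, s) = polar (t', s')) : s = s' ∧ ∃ k : ℤ, t' - t = 2 * Real.pi * k := by
  obtain rfl : s = s' := by
    have hnorm := congrArg normSq h
    rw [normSq_polar t hs.le, normSq_polar t' hs'.le] at hnorm
    linarith
  have hsqrt : √(2 * s) ≠ 0 := (Real.sqrt_pos.2 (by linarith)).ne'
  simp only [polar, Prod.mk.injEq, mul_right_inj' hsqrt] at h
  exact ⟨rfl, Real.Angle.angle_eq_iff_two_pi_dvd_sub.1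
    (Real.Angle.cos_sin_inj h.2.symm h.1.symm)⟩

theorem contDiffAt_polar {w : ℝ × ℝ} (hw : 0 < w.2) : ContDiffAt ℝ ∞ polar w := by
  have hsqrt : ContDiffAt ℝ ∞ (fun w : ℝ × ℝ ↦ √(2 * w.2)) w :=
    (contDiffAt_const.mul contDiffAt_snd).sqrt (by linarith)
  exact (hsqrt.mul contDiffAt_fst.sin).prodMk (hsqrt.mul contDiffAt_fst.cos)

theorem hasPullbackAt_polar {w : ℝ × ℝ} (hw : 0 < w.2) : HasPullbackAt polar area area w := by
  have hsqrt := ((hasFDerivAt_snd (𝕜 := ℝ) (p := w)).const_mul 2).sqrt (by linarith)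
  refine ⟨_, (hsqrt.mul hasFDerivAt_fst.sin).prodMk (hsqrt.mul hasFDerivAt_fst.cos),
    fun u v ↦ ?_⟩
  have hpos : 0 < √(2 * w.2) := Real.sqrt_pos.2 (by linarith)
  generalize √(2 * w.2) = r at hpos
  simp only [one_div, mul_inv_rev, ContinuousLinearMap.prod_apply, add_apply, smul_apply,
    ContinuousLinearMap.coe_fst', smul_eq_mul, ContinuousLinearMap.coe_snd', neg_mul, mul_neg,
    area_apply]
  field_simp
  linear_combination r ^ 2 * (u.1 * v.2 - u.2 * v.1) * Real.sin_sq_add_cos_sq w.1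

/-- The area of the part of the unit disc to the left of the vertical line through `x`. -/
def discAngle (x : ℝ) : ℝ := Real.arcsin x + x * √(1 - x ^ 2) + Real.pi / 2

/-- An area preserving map from the unit disc to the rectangle `(0, π) × (0, 1)`. -/
def discToRect (b : ℝ × ℝ) : ℝ × ℝ := (discAngle b.1, b.2 / (2 * √(1 - b.1 ^ 2)) + 1 / 2)

theorem mem_Ioo_of_normSq_lt_one {b : ℝ × ℝ} (hb : normSq b < 1) : b.1 ∈ Set.Ioo (-1 : ℝ) 1 := by
  rw [normSq] at hb
  exact abs_lt.1 ((sq_lt_one_iff_abs_lt_one _).1 (by linarith [sq_nonneg b.2]))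

theorem one_sub_sq_pos {x : ℝ} (hx : x ∈ Set.Ioo (-1 : ℝ) 1) : 0 < 1 - x ^ 2 :=
  sub_pos.2 ((sq_lt_one_iff_abs_lt_one _).2 (abs_lt.2 hx))

theorem hasDerivAt_discAngle {x : ℝ} (hx : x ∈ Set.Ioo (-1 : ℝ) 1) :
    HasDerivAt discAngle (2 * √(1 - x ^ 2)) x := by
  have hpos := one_sub_sq_pos hx
  have harcsin : HasDerivAt Real.arcsin (1 / √(1 - x ^ 2)) x :=
    Real.hasDerivAt_arcsin hx.1.ne' hx.2.ne
  have hsqrt := ((hasDerivAt_pow 2 x).const_sub 1).sqrt hpos.ne'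
  refine HasDerivAt.congr_deriv (f := discAngle)
    ((harcsin.add ((hasDerivAt_id x).mul hsqrt)).add_const (Real.pi / 2)) ?_
  have hne : √(1 - x ^ 2) ≠ 0 := (Real.sqrt_pos.2 hpos).ne'
  simp only [id_eq, Nat.cast_ofNat, Nat.add_one_sub_one, pow_one]
  field_simp [hne]
  rw [Real.sq_sqrt hpos.le]
  ring

theorem continuous_discAngle : Continuous discAngle :=
  (Real.continuous_arcsin.add (by fun_prop)).add continuous_const

theorem strictMonoOn_discAngle : StrictMonoOn discAngle (Set.Icc (-1) 1) := by
  refine strictMonoOn_of_deriv_pos (convex_Icc _ _) continuous_discAngle.continuousOn fun x hx ↦ ?_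
  rw [interior_Icc] at hx
  rw [(hasDerivAt_discAngle hx).deriv]
  exact mul_pos two_pos (Real.sqrt_pos.2 (one_sub_sq_pos hx))

theorem discAngle_mem_Ioo {x : ℝ} (hx : x ∈ Set.Ioo (-1 : ℝ) 1) :
    discAngle x ∈ Set.Ioo 0 Real.pi := by
  have hleft : discAngle (-1) = 0 := by simp [discAngle]
  have hright : discAngle 1 = Real.pi := by simp [discAngle]
  have hx' := Set.Ioo_subset_Icc_self hx
  exact ⟨hleft ▸ strictMonoOn_discAngle (by norm_num) hx' hx.1,
    hright ▸ strictMonoOn_discAngle hx' (by norm_num) hx.2⟩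

theorem discToRect_mem {b : ℝ × ℝ} (hb : normSq b < 1) :
    discToRect b ∈ Set.Ioo 0 Real.pi ×ˢ Set.Ioo (0 : ℝ) 1 := by
  have hpos := one_sub_sq_pos (mem_Ioo_of_normSq_lt_one hb)
  refine ⟨discAngle_mem_Ioo (mem_Ioo_of_normSq_lt_one hb), ?_⟩
  have hsqrt : 0 < √(1 - b.1 ^ 2) := Real.sqrt_pos.2 hpos
  have habs : |b.2 / √(1 - b.1 ^ 2)| < 1 := by
    rw [abs_div, abs_of_pos hsqrt, div_lt_one hsqrt]
    apply abs_lt_of_sq_lt_sq _ hsqrt.le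
    rw [Real.sq_sqrt hpos.le]
    linarith [show b.1 ^ 2 + b.2 ^ 2 < 1 from hb]
  have hhalf : (discToRect b).2 = b.2 / √(1 - b.1 ^ 2) / 2 + 1 / 2 := by
    rw [discToRect, mul_comm, div_mul_eq_div_div]
  rw [hhalf]
  rw [abs_lt] at habs
  constructor <;> linarith

theorem discToRect_inj {b b' : ℝ × ℝ} (hb : normSq b < 1) (hb' : normSq b' < 1)
    (h : discToRect b = discToRect b') : b = b' := by
  have hx := mem_Ioo_of_normSq_lt_one hb
  simp only [discToRect, Prod.mk.injEq, add_left_inj] at h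
  have hfst : b.1 = b'.1 := strictMonoOn_discAngle.injOn (Set.Ioo_subset_Icc_self hx)
    (Set.Ioo_subset_Icc_self (mem_Ioo_of_normSq_lt_one hb')) h.1
  refine Prod.ext hfst ?_
  rw [← hfst] at h
  exact (div_left_inj' (mul_pos two_pos (Real.sqrt_pos.2 (one_sub_sq_pos hx))).ne').1 h.2

theorem contDiffAt_discToRect {b : ℝ × ℝ} (hb : normSq b < 1) : ContDiffAt ℝ ∞ discToRect b := by
  have hx := mem_Ioo_of_normSq_lt_one hb
  have hpos := one_sub_sq_pos hx
  have harcsin : ContDiffAt ℝ ∞ (fun b : ℝ × ℝ ↦ Real.arcsin b.1) b :=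
    (Real.contDiffAt_arcsin hx.1.ne' hx.2.ne).comp b contDiffAt_fst
  have hsqrt : ContDiffAt ℝ ∞ (fun b : ℝ × ℝ ↦ √(1 - b.1 ^ 2)) b :=
    (contDiffAt_const.sub (contDiffAt_fst.pow 2)).sqrt hpos.ne'
  have hne : 2 * √(1 - b.1 ^ 2) ≠ 0 := (mul_pos two_pos (Real.sqrt_pos.2 hpos)).ne'
  exact ((harcsin.add (contDiffAt_fst.mul hsqrt)).add contDiffAt_const).prodMk
    ((contDiffAt_snd.div (contDiffAt_const.mul hsqrt) hne).add contDiffAt_const)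

theorem hasPullbackAt_discToRect {b : ℝ × ℝ} (hb : normSq b < 1) :
    HasPullbackAt discToRect area area b := by
  have hx := mem_Ioo_of_normSq_lt_one hb
  have hpos := one_sub_sq_pos hx
  have hsqrt : √(1 - b.1 ^ 2) ≠ 0 := (Real.sqrt_pos.2 hpos).ne'
  have hwidth : HasDerivAt (fun x : ℝ ↦ (2 * √(1 - x ^ 2))⁻¹)
      (deriv (fun x : ℝ ↦ (2 * √(1 - x ^ 2))⁻¹) b.1) b.1 := by
    have hsq : DifferentiableAt ℝ (fun x : ℝ ↦ 1 - x ^ 2) b.1 := by fun_prop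
    exact (((hsq.sqrt hpos.ne').const_mul 2).inv (mul_ne_zero two_ne_zero hsqrt)).hasDerivAt
  refine ⟨_, ((hasDerivAt_discAngle hx).comp_hasFDerivAt b hasFDerivAt_fst).prodMk
    ((hasFDerivAt_snd.mul (hwidth.comp_hasFDerivAt b hasFDerivAt_fst)).add_const (1 / 2)),
    fun u v ↦ ?_⟩
  simp only [mul_inv_rev, Function.comp_apply, ContinuousLinearMap.prod_apply, smul_apply,
    ContinuousLinearMap.coe_fst', smul_eq_mul, add_apply, ContinuousLinearMap.coe_snd', area_apply]
  field_simp [hsqrt]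
  ring

/-! ### The profile functions -/

/-- A nondecreasing function with `progress (q + 1) = progress q + 1` that is constant away from the
places, modulo `1`, at which `twist` and `roof` vary. -/
def progress (q : ℝ) : ℝ :=
  (staircase (q - 9 / 24) + staircase (q - 33 / 24) + staircase (q - 14 / 24)
    + staircase (q - 38 / 24)) / 2

/-- The angle by which the second factor is rotated over the point `q` of the strip: it increases by
`π` on each of `[33 / 24, 34 / 24]` and `[38 / 24, 39 / 24]` modulo `2`. -/
def twist (q : ℝ) : ℝ := Real.pi * (staircase (q - 33 / 24) + staircase (q - 38 / 24))

/-- The extra height that the strand of the strip over `q` needs in order to pass above the strand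
over `q + 1`, which is being rotated. -/
def roof (q : ℝ) : ℝ := Real.pi * deriv staircase (q - 14 / 24)

/-- A function of period `2` that decides which of the strands over `q` and `q + 1` lies above the
other: it is `0` near `0` and `1` near `1`. -/
def level (q : ℝ) : ℝ := staircase (q - 11 / 24) - staircase (q - 35 / 24)

theorem contDiff_progress : ContDiff ℝ ∞ progress := by
  have hstaircase := contDiff_staircase
  unfold progress; fun_prop

theorem contDiff_twist : ContDiff ℝ ∞ twist := by
  have hstaircase := contDiff_staircase
  unfold twist; fun_prop

theorem contDiff_roof : ContDiff ℝ ∞ roof := by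
  have hderiv := contDiff_deriv_staircase
  unfold roof; fun_prop

theorem contDiff_level : ContDiff ℝ ∞ level := by
  have hstaircase := contDiff_staircase
  unfold level; fun_prop

theorem contDiff_deriv_progress : ContDiff ℝ ∞ (deriv progress) :=
  (contDiff_infty_iff_deriv.1 contDiff_progress).2

theorem contDiff_deriv_twist : ContDiff ℝ ∞ (deriv twist) :=
  (contDiff_infty_iff_deriv.1 contDiff_twist).2

theorem hasDerivAt_staircase_sub (a q : ℝ) :
    HasDerivAt (fun q ↦ staircase (q - a)) (deriv staircase (q - a)) q :=
  HasDerivAt.comp_sub_const q a (differentiable_staircase (q - a)).hasDerivAt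

theorem deriv_progress (q : ℝ) : deriv progress q =
    (deriv staircase (q - 9 / 24) + deriv staircase (q - 33 / 24) + deriv staircase (q - 14 / 24)
      + deriv staircase (q - 38 / 24)) / 2 :=
  ((((hasDerivAt_staircase_sub _ q).add (hasDerivAt_staircase_sub _ q)).add
    (hasDerivAt_staircase_sub _ q)).add (hasDerivAt_staircase_sub _ q)).div_const 2 |>.deriv

theorem deriv_twist (q : ℝ) : deriv twist q =
    Real.pi * (deriv staircase (q - 33 / 24) + deriv staircase (q - 38 / 24)) :=
  ((hasDerivAt_staircase_sub _ q).add (hasDerivAt_staircase_sub _ q)).const_mul Real.pi |>.deriv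

theorem staircase_add_two_sub (q a : ℝ) : staircase (q + 2 - a) = staircase (q - a) + 1 := by
  rw [← staircase_add_two, sub_add_eq_add_sub]

theorem deriv_staircase_add_two_sub (q a : ℝ) :
    deriv staircase (q + 2 - a) = deriv staircase (q - a) := by
  rw [← deriv_staircase_add_two (q - a), sub_add_eq_add_sub]

theorem progress_add_one (q : ℝ) : progress (q + 1) = progress q + 1 := by
  have h₃₃ := staircase_add_two_sub q (33 / 24)
  have h₃₈ := staircase_add_two_sub q (38 / 24)
  unfold progress
  ring_nf at h₃₃ h₃₈ ⊢
  rw [h₃₃, h₃₈]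
  ring

theorem progress_add_int (q : ℝ) (k : ℤ) : progress (q + k) = progress q + k := by
  have hperiodic : Function.Periodic (fun q ↦ progress q - q) 1 := fun q ↦ by
    simp only [progress_add_one]; ring
  have hk := hperiodic.int_mul k q
  simp only [mul_one] at hk
  linarith

theorem deriv_progress_add_int (q : ℝ) (k : ℤ) : deriv progress (q + k) = deriv progress q := by
  rw [← deriv_comp_add_const, funext fun q ↦ progress_add_int q k, deriv_add_const]

theorem twist_add_two (q : ℝ) : twist (q + 2) = twist q + 2 * Real.pi := by
  simp only [twist, staircase_add_two_sub]; ring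

theorem periodic_deriv_twist : Function.Periodic (deriv twist) 2 := fun q ↦ by
  simp only [deriv_twist, deriv_staircase_add_two_sub]

theorem periodic_roof : Function.Periodic roof 2 := fun q ↦ by
  simp only [roof, deriv_staircase_add_two_sub]

theorem periodic_level : Function.Periodic level 2 := fun q ↦ by
  simp only [level, staircase_add_two_sub]; ring

theorem deriv_progress_nonneg (q : ℝ) : 0 ≤ deriv progress q := by
  have h := deriv_staircase_nonneg
  rw [deriv_progress]
  linarith [h (q - 9 / 24), h (q - 33 / 24), h (q - 14 / 24), h (q - 38 / 24)]

theorem roof_nonneg (q : ℝ) : 0 ≤ roof q := mul_nonneg Real.pi_pos.le (deriv_staircase_nonneg _)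

theorem deriv_twist_nonneg (q : ℝ) : 0 ≤ deriv twist q := by
  rw [deriv_twist]
  exact mul_nonneg Real.pi_pos.le (add_nonneg (deriv_staircase_nonneg _) (deriv_staircase_nonneg _))

theorem roof_add_deriv_twist_le (q : ℝ) :
    roof q + deriv twist q ≤ 2 * Real.pi * deriv progress q := by
  have h := mul_nonneg Real.pi_pos.le (deriv_staircase_nonneg (q - 9 / 24))
  rw [roof, deriv_twist, deriv_progress]
  linarith

theorem level_nonneg (q : ℝ) : 0 ≤ level q :=
  sub_nonneg.2 (monotone_staircase (by linarith))

theorem level_le_one (q : ℝ) : level q ≤ 1 := by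
  have hmono := monotone_staircase (show q - 11 / 24 ≤ q - 35 / 24 + 2 by linarith)
  rw [staircase_add_two] at hmono
  rw [level]
  linarith

section Intervals

variable {q : ℝ} (i : ℤ)

theorem level_eq_zero (h₁ : 2 * i - 12 / 24 ≤ q) (h₂ : q ≤ 2 * i + 11 / 24) : level q = 0 := by
  rw [level, staircase_eq_intCast i (by linarith) (by linarith),
    staircase_eq_intCast i (by linarith) (by linarith), sub_self]

theorem level_eq_one (h₁ : 2 * i + 12 / 24 ≤ q) (h₂ : q ≤ 2 * i + 35 / 24) : level q = 1 := by
  rw [level, staircase_eq_intCast (i + 1) (by push_cast; linarith) (by push_cast; linarith),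
    staircase_eq_intCast i (by linarith) (by linarith), Int.cast_add, Int.cast_one,
    add_sub_cancel_left]

theorem roof_eq_zero (h₁ : 2 * i - 33 / 24 < q) (h₂ : q < 2 * i + 14 / 24) : roof q = 0 := by
  rw [roof, deriv_staircase_eq_zero i (by linarith) (by linarith), mul_zero]

theorem twist_eq (h₁ : 2 * i - 9 / 24 ≤ q) (h₂ : q ≤ 2 * i + 33 / 24) :
    twist q = 2 * Real.pi * i := by
  rw [twist, staircase_eq_intCast i (by linarith) (by linarith),
    staircase_eq_intCast i (by linarith) (by linarith)]
  ring

theorem twist_eq_add_pi (h₁ : 2 * i + 34 / 24 ≤ q) (h₂ : q ≤ 2 * i + 38 / 24) :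
    twist q = 2 * Real.pi * i + Real.pi := by
  rw [twist, staircase_eq_intCast (i + 1) (by push_cast; linarith) (by push_cast; linarith),
    staircase_eq_intCast i (by linarith) (by linarith)]
  push_cast
  ring

theorem deriv_twist_eq_zero (h₁ : 2 * i - 9 / 24 < q) (h₂ : q < 2 * i + 33 / 24) :
    deriv twist q = 0 := by
  rw [deriv_twist, deriv_staircase_eq_zero i (by linarith) (by linarith),
    deriv_staircase_eq_zero i (by linarith) (by linarith), add_zero, mul_zero]

theorem deriv_twist_add_one_eq_roof (h₁ : 2 * i + 10 / 24 < q) (h₂ : q < 2 * i + 57 / 24) :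
    deriv twist (q + 1) = roof q := by
  rw [deriv_twist, deriv_staircase_eq_zero (i + 1) (by push_cast; linarith)
    (by push_cast; linarith), zero_add, roof]
  congr 2
  ring

end Intervals

/-! ### Winding the strip around an annulus -/

/-- Straightening the fibres by the twist `T` is symplectic because the momentum conjugate to the
rotated angle is added, with weight `T'`, to the coordinate across the annulus. -/
theorem hasPullbackAt_wind {X X' g T T' : ℝ → ℝ} {c : ℝ} {w : (ℝ × ℝ) × (ℝ × ℝ)}
    (hX : HasDerivAt X (X' w.1.1) w.1.1) (hX' : DifferentiableAt ℝ X' w.1.1)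
    (hne : X' w.1.1 ≠ 0) (hg : DifferentiableAt ℝ g w.1.1)
    (hT : HasDerivAt T (T' w.1.1) w.1.1) (hT' : DifferentiableAt ℝ T' w.1.1) :
    HasPullbackAt
      (fun w : (ℝ × ℝ) × (ℝ × ℝ) ↦
        ((X w.1.1, (c * w.1.2 + g w.1.1 + T' w.1.1 * w.2.2) / X' w.1.1),
          (w.2.1 - T w.1.1, w.2.2)))
      (prodForm area area) (prodForm (c • area) area) w := by
  have hfst : HasFDerivAt Prod.fst (ContinuousLinearMap.fst ℝ (ℝ × ℝ) (ℝ × ℝ)) w := hasFDerivAt_fst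
  have hsnd : HasFDerivAt Prod.snd (ContinuousLinearMap.snd ℝ (ℝ × ℝ) (ℝ × ℝ)) w := hasFDerivAt_snd
  have hq := hfst.fst
  have hacross := ((hfst.snd.const_mul c).add (hg.hasDerivAt.comp_hasFDerivAt w hq)).add
    ((hT'.hasDerivAt.comp_hasFDerivAt w hq).mul hsnd.snd)
  have hinv := (hX'.inv hne).hasDerivAt.comp_hasFDerivAt w hq
  refine ⟨_, ((hX.comp_hasFDerivAt w hq).prodMk (hacross.mul hinv)).prodMk
    ((hsnd.fst.sub (hT.comp_hasFDerivAt w hq)).prodMk hsnd.snd), fun u v ↦ ?_⟩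
  simp only [Pi.add_apply, Function.comp_apply, Pi.mul_apply, Pi.inv_apply, smul_add,
    ContinuousLinearMap.prod_apply, smul_apply, ContinuousLinearMap.comp_apply,
    ContinuousLinearMap.coe_fst', smul_eq_mul, add_apply, ContinuousLinearMap.coe_snd', sub_apply,
    prodForm_apply, area_apply, LinearMap.smul_apply]
  field_simp
  ring

/-- The angle in the annulus of the points of the strip over `q`. The strip winds around twice in
each period `2`, moving at least at the speed `K * ε`. -/
def position (K ε q : ℝ) : ℝ := K * ε * q + (2 * Real.pi - K * ε) * progress q

/-- The derivative of `position`. -/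
def speed (K ε q : ℝ) : ℝ := K * ε + (2 * Real.pi - K * ε) * deriv progress q

/-- The lower edge of the strip over `q`, before the contribution of the twist. -/
def lowerEdge (ε q : ℝ) : ℝ := ε / 2 * (1 + totalHeight q * level q) + roof q

/-- The coordinate across the annulus, multiplied by `speed`, of the point of the strip at height
`y` over `q`, when the momentum in the second factor is `R`. -/
def offset (ε q y R : ℝ) : ℝ := ε / 2 * y + lowerEdge ε q + deriv twist q * R

/-- The embedding in action-angle coordinates of both factors. -/
def flatMap (K ε : ℝ) (w : (ℝ × ℝ) × (ℝ × ℝ)) : (ℝ × ℝ) × (ℝ × ℝ) :=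
  ((position K ε w.1.1, offset ε w.1.1 w.1.2 w.2.2 / speed K ε w.1.1),
    (w.2.1 - twist w.1.1, w.2.2))

/-- The embedding on the product of the strip and the rectangle. -/
def model (K ε : ℝ) (w d : ℝ × ℝ) : (ℝ × ℝ) × (ℝ × ℝ) :=
  Prod.map polar polar (flatMap K ε ((w.1, height w), d))

section Model

variable {K ε : ℝ}

theorem speed_pos (hKε : K * ε ∈ Set.Ioo 0 (2 * Real.pi)) (q : ℝ) : 0 < speed K ε q :=
  add_pos_of_pos_of_nonneg hKε.1 (mul_nonneg (sub_pos.2 hKε.2).le (deriv_progress_nonneg q))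

theorem hasDerivAt_position (q : ℝ) : HasDerivAt (position K ε) (speed K ε q) q := by
  have hlinear := (hasDerivAt_id q).const_mul (K * ε)
  rw [mul_one] at hlinear
  exact hlinear.add
    ((contDiff_progress.differentiable (by simp) q).hasDerivAt.const_mul _)

theorem strictMono_position (hKε : K * ε ∈ Set.Ioo 0 (2 * Real.pi)) :
    StrictMono (position K ε) :=
  strictMono_of_deriv_pos fun q ↦ by rw [(hasDerivAt_position q).deriv]; exact speed_pos hKε q

theorem position_add_int (q : ℝ) (k : ℤ) :
    position K ε (q + k) = position K ε q + k * (2 * Real.pi) := by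
  simp only [position, progress_add_int]; ring

theorem speed_add_int (q : ℝ) (k : ℤ) : speed K ε (q + k) = speed K ε q := by
  rw [speed, deriv_progress_add_int, speed]

theorem totalHeight_add_int (q : ℝ) (k : ℤ) : totalHeight (q + k) = totalHeight q := by
  simpa using periodic_totalHeight.int_mul k q

theorem offset_add_two (ε q y R : ℝ) : offset ε (q + 2) y R = offset ε q y R := by
  have htotal := totalHeight_add_int q 2
  push_cast at htotal
  simp only [offset, lowerEdge, htotal, periodic_roof q, periodic_level q, periodic_deriv_twist q]

theorem lowerEdge_pos (hε : 0 < ε) (q : ℝ) : 0 < lowerEdge ε q := by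
  have hlevel := mul_nonneg (totalHeight_pos q).le (level_nonneg q)
  exact add_pos_of_pos_of_nonneg (by positivity) (roof_nonneg q)

theorem offset_pos (hε : 0 < ε) {q y R : ℝ} (hy : 0 ≤ y) (hR : 0 ≤ R) : 0 < offset ε q y R := by
  have hlower := lowerEdge_pos hε q
  have htwist := mul_nonneg (deriv_twist_nonneg q) hR
  have hy' : 0 ≤ ε / 2 * y := by positivity
  rw [offset]
  linarith

theorem offset_lt (hε : 0 < ε) (hKε : K * ε ≤ 1) {q v R : ℝ} (hK : 1 + 2 * totalHeight q ≤ K)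
    (hv : v < 1) (hR : R ≤ 1) :
    offset ε q (height (q, v)) R < (1 + K * ε) * speed K ε q := by
  have hprogress := deriv_progress_nonneg q
  have hlevel := mul_le_mul_of_nonneg_left (level_le_one q) (totalHeight_pos q).le
  have hKε₀ : 0 < K * ε := mul_pos (by linarith [totalHeight_pos q]) hε
  have hheights : ε / 2 * (1 + height (q, v) + totalHeight q * level q) < ε * K :=
    calc ε / 2 * (1 + height (q, v) + totalHeight q * level q) ≤ ε / 2 * K :=
          mul_le_mul_of_nonneg_left (by linarith [height_lt_totalHeight q hv]) (by linarith)
      _ < ε * K := by linarith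
  have hoffset : offset ε q (height (q, v)) R < K * ε + 2 * Real.pi * deriv progress q := by
    have htwist := mul_le_mul_of_nonneg_left hR (deriv_twist_nonneg q)
    rw [offset, lowerEdge]
    linarith [roof_add_deriv_twist_le q]
  have hfactor : 2 * Real.pi ≤ (1 + K * ε) * (2 * Real.pi - K * ε) := by
    nlinarith [Real.pi_gt_three]
  calc offset ε q (height (q, v)) R < K * ε + 2 * Real.pi * deriv progress q := hoffset
    _ ≤ (1 + K * ε) * (K * ε) + (1 + K * ε) * (2 * Real.pi - K * ε) * deriv progress q :=
        add_le_add (by nlinarith) (mul_le_mul_of_nonneg_right hfactor hprogress)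
    _ = (1 + K * ε) * speed K ε q := by rw [speed]; ring

theorem model_mem_ball {w d : ℝ × ℝ} (hε : 0 < ε) (hKε : K * ε ≤ 1)
    (hK : ∀ q, 1 + 2 * totalHeight q ≤ K) (hw : w.2 ∈ Set.Ico (0 : ℝ) 1)
    (hd : d.2 ∈ Set.Ioo (0 : ℝ) 1) :
    normSq (model K ε w d).1 < (√2 + K * ε) ^ 2 ∧ normSq (model K ε w d).2 < 2 := by
  have hKε₀ : 0 < K * ε := mul_pos (by linarith [totalHeight_pos 0, hK 0]) hε
  have hspeed := speed_pos ⟨hKε₀, by linarith [Real.pi_gt_three]⟩ w.1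
  have hoffset := offset_pos hε (q := w.1) (height_nonneg w.1 hw.1) hd.1.le
  have hradius := (div_lt_iff₀ hspeed).2 (offset_lt hε hKε (hK w.1) hw.2 hd.2.le)
  constructor
  · have hsqrt : 1 ≤ √2 := Real.one_le_sqrt.2 one_le_two
    calc normSq (model K ε w d).1
        = 2 * (offset ε w.1 (height w) d.2 / speed K ε w.1) :=
          normSq_polar _ (div_pos hoffset hspeed).le
      _ < 2 * (1 + K * ε) := mul_lt_mul_of_pos_left hradius two_pos
      _ ≤ (√2 + K * ε) ^ 2 := by nlinarith [Real.sq_sqrt (zero_le_two (α := ℝ))]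
  · calc normSq (model K ε w d).2 = 2 * d.2 := normSq_polar _ hd.1.le
      _ < 2 := by linarith [hd.2]

theorem model_add_int_eq (w d : ℝ × ℝ) {v : ℝ} (k : ℤ)
    (htwist : twist (w.1 + k) = twist w.1 + 2 * Real.pi)
    (hoffset : offset ε (w.1 + k) (height (w.1 + k, v)) d.2 = offset ε w.1 (height w) d.2) :
    model K ε (w.1 + k, v) d = model K ε w d := by
  have hturn := polar_add_int_mul_two_pi (d.1 - (twist w.1 + 2 * Real.pi)) d.2 1
  rw [Int.cast_one, one_mul, sub_add_eq_sub_sub, sub_add_cancel] at hturn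
  simp only [model, flatMap, Prod.map, position_add_int, polar_add_int_mul_two_pi, speed_add_int,
    hoffset, htwist, sub_add_eq_sub_sub, hturn]

theorem model_add_two (w d : ℝ × ℝ) : model K ε (w.1 + 2, w.2) d = model K ε w d :=
  model_add_int_eq w d 2 (twist_add_two w.1) (by
    rw [Int.cast_ofNat, offset_add_two, height_add_two])

theorem model_add_int_mul_two (w d : ℝ × ℝ) (k : ℤ) :
    model K ε (w.1 + k * 2, w.2) d = model K ε w d := by
  have hperiodic : Function.Periodic (fun q ↦ model K ε (q, w.2) d) 2 := fun q ↦
    model_add_two (q, w.2) d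
  exact hperiodic.int_mul k w.1

theorem model_add_one {j : ℤ} {w : ℝ × ℝ} (hwindow : |w.1 - (2 * j + 1)| < 1 / 3) (d : ℝ × ℝ) :
    model K ε (w.1 + 1, w.2 + 1) d = model K ε w d := by
  obtain ⟨hlower, hupper⟩ := abs_lt.1 hwindow
  have hnext : ((j + 1 : ℤ) : ℝ) = j + 1 := by push_cast; rfl
  rw [← Int.cast_one (R := ℝ)]
  apply model_add_int_eq
  · rw [Int.cast_one, twist_eq j (q := w.1) (by linarith) (by linarith),
      twist_eq (j + 1) (q := w.1 + 1) (by linarith) (by linarith), hnext]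
    ring
  · rw [Int.cast_one, height_add_one]
    simp only [offset, lowerEdge, periodic_totalHeight w.1,
      level_eq_one j (q := w.1) (by linarith) (by linarith),
      level_eq_zero (j + 1) (q := w.1 + 1) (by linarith) (by linarith),
      roof_eq_zero (j + 1) (q := w.1) (by linarith) (by linarith),
      roof_eq_zero (j + 1) (q := w.1 + 1) (by linarith) (by linarith),
      deriv_twist_eq_zero j (q := w.1) (by linarith) (by linarith),
      deriv_twist_eq_zero (j + 1) (q := w.1 + 1) (by linarith) (by linarith)]
    ring

theorem eq_zero_of_sub_eq_mul {L x y : ℝ} (hx : x ∈ Set.Ioo 0 L) (hy : y ∈ Set.Ioo 0 L) {k : ℤ}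
    (h : y - x = L * k) : k = 0 := by
  have hL : 0 < L := hx.1.trans hx.2
  have hlt : |L * k| < L * 1 := by
    rw [← h, mul_one, abs_lt]
    constructor <;> linarith [hx.1, hx.2, hy.1, hy.2]
  rw [abs_mul, abs_of_pos hL, mul_lt_mul_iff_right₀ hL] at hlt
  exact Int.abs_lt_one_iff.1 (by exact_mod_cast hlt)

theorem offset_lt_offset_add_one (hε : 0 < ε) {q y y' R : ℝ} {i : ℤ} (hq : 2 * i ≤ q)
    (hq' : q < 2 * i + 11 / 24) (hy : y < totalHeight q) (hy' : 0 ≤ y') (hR : 0 ≤ R) :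
    offset ε q y R < offset ε (q + 1) y' R := by
  have htwist := mul_nonneg (deriv_twist_nonneg (q + 1)) hR
  have hroof := roof_nonneg (q + 1)
  have hheight : ε / 2 * y < ε / 2 * (y' + totalHeight q) :=
    mul_lt_mul_of_pos_left (by linarith) (by linarith)
  simp only [offset, lowerEdge, periodic_totalHeight q,
    level_eq_zero i (q := q) (by linarith) (by linarith),
    level_eq_one i (q := q + 1) (by linarith) (by linarith),
    roof_eq_zero i (q := q) (by linarith) (by linarith),
    deriv_twist_eq_zero i (q := q) (by linarith) (by linarith)]
  linarith

theorem offset_add_one_lt_offset (hε : 0 < ε) {q y y' R : ℝ} {i : ℤ} (hq : 2 * i + 12 / 24 < q)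
    (hq' : q < 2 * i + 1) (hy : 0 ≤ y) (hy' : y' < totalHeight q) (hR : R ≤ 1) :
    offset ε (q + 1) y' R < offset ε q y R := by
  have hnext : ((i + 1 : ℤ) : ℝ) = i + 1 := by push_cast; rfl
  have hroof := mul_le_mul_of_nonneg_left hR (roof_nonneg q)
  have hheight : ε / 2 * y' < ε / 2 * (y + totalHeight q) :=
    mul_lt_mul_of_pos_left (by linarith) (by linarith)
  simp only [offset, lowerEdge, periodic_totalHeight q,
    level_eq_one i (q := q) (by linarith) (by linarith),
    level_eq_zero (i + 1) (q := q + 1) (by linarith) (by linarith),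
    roof_eq_zero (i + 1) (q := q + 1) (by linarith) (by linarith),
    deriv_twist_eq_zero i (q := q) (by linarith) (by linarith),
    deriv_twist_add_one_eq_roof i (q := q) (by linarith) (by linarith)]
  linarith

theorem exists_int_of_model_eq (hε : 0 < ε) (hKε : K * ε ∈ Set.Ioo 0 (2 * Real.pi))
    {w w' d d' : ℝ × ℝ} (hw : 0 ≤ w.2) (hw' : 0 ≤ w'.2) (hd : 0 < d.2) (hd' : 0 < d'.2)
    (h : model K ε w d = model K ε w' d') :
    ∃ k l : ℤ, w'.1 = w.1 + k ∧
      offset ε w.1 (height w) d.2 = offset ε w'.1 (height w') d'.2 ∧ d.2 = d'.2 ∧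
      d'.1 - twist w'.1 - (d.1 - twist w.1) = 2 * Real.pi * l := by
  have hspeed := speed_pos hKε
  obtain ⟨hfirst, hsecond⟩ := Prod.ext_iff.1 h
  obtain ⟨hacross, k, hk⟩ := eq_of_polar_eq
    (div_pos (offset_pos hε (height_nonneg w.1 hw) hd.le) (hspeed w.1))
    (div_pos (offset_pos hε (height_nonneg w'.1 hw') hd'.le) (hspeed w'.1)) hfirst
  obtain ⟨hmomentum, l, hl⟩ := eq_of_polar_eq hd hd' hsecond
  have hq : w'.1 = w.1 + k := (strictMono_position hKε).injective <| by
    rw [position_add_int]; linarith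
  refine ⟨k, l, hq, ?_, hmomentum, hl⟩
  rwa [hq, speed_add_int, div_left_inj' (hspeed w.1).ne', ← hq] at hacross

/-- The two strands over the same angle are separated by the offset, except at the crossing, where
their half discs in the second factor are rotated against each other by `π`. -/
theorem model_ne_of_mem_Ico (hε : 0 < ε) (hKε : K * ε ∈ Set.Ioo 0 (2 * Real.pi)) {i : ℤ}
    {q v v' : ℝ} {d d' : ℝ × ℝ} (hq : q ∈ Set.Ico (2 * i : ℝ) (2 * i + 1))
    (hv : v ∈ Set.Ico (0 : ℝ) 1) (hv' : v' ∈ Set.Ico (0 : ℝ) 1)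
    (hd : d ∈ Set.Ioo 0 Real.pi ×ˢ Set.Ioo (0 : ℝ) 1)
    (hd' : d' ∈ Set.Ioo 0 Real.pi ×ˢ Set.Ioo (0 : ℝ) 1) :
    model K ε (q, v) d ≠ model K ε (q + 1, v') d' := by
  intro h
  obtain ⟨-, l, -, hoffset, hmomentum, hangle⟩ :=
    exists_int_of_model_eq hε hKε hv.1 hv'.1 hd.2.1 hd'.2.1 h
  rw [← hmomentum] at hoffset
  have hheight := height_lt_totalHeight q hv.2
  have hheight' : height (q + 1, v') < totalHeight q := by
    rw [← periodic_totalHeight q]; exact height_lt_totalHeight (q + 1) hv'.2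
  rcases lt_or_ge q (2 * i + 11 / 24) with hbefore | hq₁
  · exact (offset_lt_offset_add_one hε hq.1 hbefore hheight (height_nonneg (q + 1) hv'.1)
      hd.2.1.le).ne hoffset
  rcases lt_or_ge (2 * i + 12 / 24 : ℝ) q with hafter | hq₂
  · exact (offset_add_one_lt_offset hε hafter hq.2 (height_nonneg q hv.1) hheight'
      hd.2.2.le).ne' hoffset
  · rw [twist_eq i (q := q) (by linarith) (by linarith),
      twist_eq_add_pi i (q := q + 1) (by linarith) (by linarith)] at hangle
    have hodd := eq_zero_of_sub_eq_mul hd.1 hd'.1 (k := 2 * l + 1) (by push_cast; linarith)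
    omega

theorem model_add_one_ne (hε : 0 < ε) (hKε : K * ε ∈ Set.Ioo 0 (2 * Real.pi)) {q v v' : ℝ}
    {d d' : ℝ × ℝ} (hv : v ∈ Set.Ico (0 : ℝ) 1) (hv' : v' ∈ Set.Ico (0 : ℝ) 1)
    (hd : d ∈ Set.Ioo 0 Real.pi ×ˢ Set.Ioo (0 : ℝ) 1)
    (hd' : d' ∈ Set.Ioo 0 Real.pi ×ˢ Set.Ioo (0 : ℝ) 1) :
    model K ε (q, v) d ≠ model K ε (q + 1, v') d' := by
  have hfloor := Int.floor_le q
  have hfloor' := Int.lt_floor_add_one q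
  rcases Int.even_or_odd' ⌊q⌋ with ⟨i, hi | hi⟩ <;> rw [hi] at hfloor hfloor' <;>
    push_cast at hfloor hfloor'
  · exact model_ne_of_mem_Ico hε hKε ⟨hfloor, hfloor'⟩ hv hv' hd hd'
  · have hne := model_ne_of_mem_Ico hε hKε (i := i) (q := q - 1)
      ⟨by linarith, by linarith⟩ hv' hv hd' hd
    rw [sub_add_cancel, ← model_add_two (q - 1, v') d',
      show q - 1 + 2 = q + 1 by ring] at hne
    exact hne.symm

theorem eq_of_model_eq_of_fst_eq (hε : 0 < ε) (hKε : K * ε ∈ Set.Ioo 0 (2 * Real.pi))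
    {q v v' : ℝ} {d d' : ℝ × ℝ} (hv : 0 ≤ v) (hv' : 0 ≤ v')
    (hd : d ∈ Set.Ioo 0 Real.pi ×ˢ Set.Ioo (0 : ℝ) 1)
    (hd' : d' ∈ Set.Ioo 0 Real.pi ×ˢ Set.Ioo (0 : ℝ) 1)
    (h : model K ε (q, v) d = model K ε (q, v') d') : v' = v ∧ d = d' := by
  obtain ⟨-, l, -, hoffset, hmomentum, hangle⟩ :=
    exists_int_of_model_eq hε hKε hv hv' hd.2.1 hd'.2.1 h
  have hl := eq_zero_of_sub_eq_mul hd.1 hd'.1 (k := 2 * l) (by push_cast; linarith)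
  have hangle' : d.1 = d'.1 := by
    obtain rfl : l = 0 := by omega
    rw [Int.cast_zero] at hangle
    linarith
  refine ⟨(strictMono_height q).injective ?_, Prod.ext hangle' hmomentum⟩
  rw [← hmomentum] at hoffset
  have hheight : ε / 2 * height (q, v') = ε / 2 * height (q, v) := by
    simp only [offset] at hoffset; linarith
  exact mul_left_cancel₀ (half_pos hε).ne' hheight

theorem model_inj (hε : 0 < ε) (hKε : K * ε ∈ Set.Ioo 0 (2 * Real.pi)) {w w' d d' : ℝ × ℝ}
    (hw : w.2 ∈ Set.Ico (0 : ℝ) 1) (hw' : w'.2 ∈ Set.Ico (0 : ℝ) 1)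
    (hd : d ∈ Set.Ioo 0 Real.pi ×ˢ Set.Ioo (0 : ℝ) 1)
    (hd' : d' ∈ Set.Ioo 0 Real.pi ×ˢ Set.Ioo (0 : ℝ) 1)
    (h : model K ε w d = model K ε w' d') :
    (∃ k : ℤ, w'.1 = w.1 + 2 * k) ∧ w'.2 = w.2 ∧ d = d' := by
  obtain ⟨k, -, hk, -⟩ := exists_int_of_model_eq hε hKε hw.1 hw'.1 hd.2.1 hd'.2.1 h
  rcases Int.even_or_odd' k with ⟨m, rfl | rfl⟩ <;> push_cast at hk
  · refine ⟨⟨m, hk⟩, eq_of_model_eq_of_fst_eq hε hKε hw.1 hw'.1 hd hd' (q := w.1) ?_⟩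
    rw [← model_add_int_mul_two (w.1, w'.2) d' m, mul_comm (m : ℝ), ← hk]
    exact h
  · refine absurd ?_ (model_add_one_ne hε hKε (q := w.1) hw hw' hd hd')
    rw [← model_add_int_mul_two (w.1 + 1, w'.2) d' m,
      show w.1 + 1 + m * 2 = w'.1 by rw [hk]; ring]
    exact h

theorem hasPullbackAt_flatMap (hKε : K * ε ∈ Set.Ioo 0 (2 * Real.pi)) (w : (ℝ × ℝ) × (ℝ × ℝ)) :
    HasPullbackAt (flatMap K ε) (prodForm area area) (prodForm ((ε / 2) • area) area) w := by
  have hprogress := contDiff_deriv_progress.differentiable (by simp)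
  have htotal := contDiff_totalHeight.differentiable (by simp)
  have hlevel := contDiff_level.differentiable (by simp)
  have hroof := contDiff_roof.differentiable (by simp)
  have htwist := contDiff_deriv_twist.differentiable (by simp)
  exact hasPullbackAt_wind (hasDerivAt_position w.1.1) (by unfold speed; fun_prop)
    (speed_pos hKε w.1.1).ne' (by unfold lowerEdge; fun_prop)
    (contDiff_twist.differentiable (by simp) w.1.1).hasDerivAt (htwist w.1.1)

theorem contDiffAt_model {p : ℝ × (ℝ × ℝ) × (ℝ × ℝ)} (hε : 0 < p.1)
    (hKε : K * p.1 ∈ Set.Ioo 0 (2 * Real.pi)) (hw : 0 ≤ p.2.1.2) (hd : 0 < p.2.2.2) :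
    ContDiffAt ℝ ∞ (fun p : ℝ × (ℝ × ℝ) × (ℝ × ℝ) ↦ model K p.1 p.2.1 p.2.2) p := by
  have hspeed := speed_pos hKε p.2.1.1
  have hoffset := offset_pos hε (q := p.2.1.1) (height_nonneg p.2.1.1 hw) hd.le
  have hheight := contDiff_height
  have hprogress := contDiff_progress
  have htotal := contDiff_totalHeight
  have hlevel := contDiff_level
  have hroof := contDiff_roof
  have htwist := contDiff_twist
  have hacross : ContDiffAt ℝ ∞ (fun p : ℝ × (ℝ × ℝ) × (ℝ × ℝ) ↦
      offset p.1 p.2.1.1 (height p.2.1) p.2.2.2 / speed K p.1 p.2.1.1) p :=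
    ContDiffAt.div (by unfold offset lowerEdge; fun_prop) (by unfold speed; fun_prop) hspeed.ne'
  have hposition : ContDiffAt ℝ ∞ (fun p : ℝ × (ℝ × ℝ) × (ℝ × ℝ) ↦ position K p.1 p.2.1.1) p := by
    unfold position; fun_prop
  have hangle : ContDiffAt ℝ ∞ (fun p : ℝ × (ℝ × ℝ) × (ℝ × ℝ) ↦
      (p.2.2.1 - twist p.2.1.1, p.2.2.2)) p := by fun_prop
  have hfirst := (contDiffAt_polar (div_pos hoffset hspeed)).comp p (hposition.prodMk hacross)
  have hsecond := ContDiffAt.comp (g := polar) p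
    (contDiffAt_polar (w := (p.2.2.1 - twist p.2.1.1, p.2.2.2)) hd) hangle
  exact hfirst.prodMk hsecond

end Model

/-! ### The lifted embedding -/

/-- The embedding, as a doubly periodic map on the product of the punctured plane and the disc. -/
def planeMap (K ε : ℝ) (z b : ℝ × ℝ) : (ℝ × ℝ) × (ℝ × ℝ) :=
  model K ε (stripCoord z) (discToRect b)

section PlaneMap

variable {K ε : ℝ}

theorem isDoublyPeriodic_planeMap (b : ℝ × ℝ) : IsDoublyPeriodic fun z ↦ planeMap K ε z b := by
  intro z m n
  simp only [planeMap]
  rw [stripCoord_add_int, ← model_add_int_mul_two (stripCoord z) (discToRect b) m, mul_comm]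
  exact congrArg (model K ε · _) (Prod.ext rfl (add_zero _))

theorem toStrip_eq_sub {w : ℝ × ℝ} {n : ℤ} (h : w.2 ∈ Set.Ico (n : ℝ) (n + 1)) :
    toStrip w = w - ((n : ℝ), (n : ℝ)) := by
  rw [toStrip, Int.fract, Int.floor_eq_iff.2 h]
  rfl

theorem model_toStrip {n j : ℤ} {w : ℝ × ℝ} (hw : w.2 ∈ Set.Ico (n - 1 : ℝ) (n + 1))
    (hwindow : |w.1 - n - (2 * j + 1)| < 1 / 3) (d : ℝ × ℝ) :
    model K ε (toStrip w) d = model K ε (w - ((n : ℝ), (n : ℝ))) d := by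
  rcases le_or_gt (n : ℝ) w.2 with habove | hbelow
  · rw [toStrip_eq_sub ⟨habove, hw.2⟩]
  · rw [toStrip_eq_sub (n := n - 1) ⟨by push_cast; exact hw.1, by push_cast; linarith⟩,
      ← model_add_one (w := w - ((n : ℝ), (n : ℝ))) hwindow d]
    congr 1
    ext <;> simp only [Prod.fst_sub, Prod.snd_sub] <;> push_cast <;> ring

theorem planeMap_eventuallyEq (K : ℝ) {z : ℝ × ℝ} (hz : z ∈ puncturedPlane) :
    ∃ n : ℤ, stripCoord z = slant (openPunctures z) - ((n : ℝ), (n : ℝ)) ∧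
      ∀ᶠ y in nhds z, ∀ ε b, planeMap K ε y b
        = model K ε (slant (openPunctures y) - ((n : ℝ), (n : ℝ))) (discToRect b) := by
  have hcont : ContinuousAt (fun y ↦ slant (openPunctures y)) z :=
    contDiff_slant.continuous.continuousAt.comp (contDiffAt_openPunctures hz).continuousAt
  set n := ⌊(slant (openPunctures z)).2⌋ with hn
  have hlower : (n : ℝ) ≤ (slant (openPunctures z)).2 := Int.floor_le _
  have hupper : (slant (openPunctures z)).2 < n + 1 := Int.lt_floor_add_one _
  refine ⟨n, toStrip_eq_sub ⟨hlower, hupper⟩, ?_⟩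
  rcases hlower.lt_or_eq with hinterior | hedge
  · filter_upwards [hcont.snd.eventually (Ioo_mem_nhds hinterior hupper)] with y hy ε b
    rw [planeMap, stripCoord, toStrip_eq_sub ⟨hy.1.le, hy.2⟩]
  · obtain ⟨j, hj⟩ := exists_abs_stripCoord_sub_odd_lt hz
      (by rw [stripCoord, toStrip, Int.fract, ← hn, ← hedge, sub_self])
    have hwindow : ContinuousAt
        (fun y ↦ |(slant (openPunctures y)).1 - n - (2 * j + 1)|) z :=
      ((hcont.fst.sub continuousAt_const).sub continuousAt_const).abs
    filter_upwards [hcont.snd.eventually (Ioo_mem_nhds (by linarith : (n : ℝ) - 1 < _) hupper),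
      hwindow.eventually (gt_mem_nhds hj)] with y hy hy' ε b
    exact model_toStrip ⟨hy.1.le, hy.2⟩ hy' _

theorem planeMap_inj (hε : 0 < ε) (hKε : K * ε ∈ Set.Ioo 0 (2 * Real.pi)) {z z' b b' : ℝ × ℝ}
    (hz : z ∈ puncturedPlane) (hz' : z' ∈ puncturedPlane) (hb : normSq b < 1) (hb' : normSq b' < 1)
    (h : planeMap K ε z b = planeMap K ε z' b') :
    (∃ m n : ℤ, z' = z + ((m : ℝ), (n : ℝ))) ∧ b = b' := by
  obtain ⟨⟨k, hk⟩, hv, hd⟩ := model_inj hε hKε (stripCoord_snd_mem_Ico z)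
    (stripCoord_snd_mem_Ico z') (discToRect_mem hb) (discToRect_mem hb') h
  exact ⟨exists_int_of_stripCoord hz hz' hk hv, discToRect_inj hb hb' hd⟩

theorem planeMap_mem_ball (hε : 0 < ε) (hKε : K * ε ≤ 1) (hK : ∀ q, 1 + 2 * totalHeight q ≤ K)
    (z : ℝ × ℝ) {b : ℝ × ℝ} (hb : normSq b < 1) :
    normSq (planeMap K ε z b).1 < (√2 + K * ε) ^ 2 ∧ normSq (planeMap K ε z b).2 < 2 :=
  model_mem_ball hε hKε hK (stripCoord_snd_mem_Ico z) (discToRect_mem hb).2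

theorem contDiffAt_planeMap {p : ℝ × (ℝ × ℝ) × (ℝ × ℝ)} (hε : 0 < p.1)
    (hKε : K * p.1 ∈ Set.Ioo 0 (2 * Real.pi)) (hz : p.2.1 ∈ puncturedPlane)
    (hb : normSq p.2.2 < 1) :
    ContDiffAt ℝ ∞ (fun p : ℝ × (ℝ × ℝ) × (ℝ × ℝ) ↦ planeMap K p.1 p.2.1 p.2.2) p := by
  obtain ⟨n, hn, heq⟩ := planeMap_eventuallyEq K hz
  have hstrip : ContDiffAt ℝ ∞ (fun p : ℝ × (ℝ × ℝ) × (ℝ × ℝ) ↦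
      slant (openPunctures p.2.1) - ((n : ℝ), (n : ℝ))) p :=
    (contDiff_slant.contDiffAt.comp p (ContDiffAt.comp (f := fun p : ℝ × (ℝ × ℝ) × (ℝ × ℝ) ↦ p.2.1)
      p (contDiffAt_openPunctures hz) (by fun_prop))).sub contDiffAt_const
  have hrect : ContDiffAt ℝ ∞ (fun p : ℝ × (ℝ × ℝ) × (ℝ × ℝ) ↦ discToRect p.2.2) p :=
    ContDiffAt.comp (f := fun p : ℝ × (ℝ × ℝ) × (ℝ × ℝ) ↦ p.2.2) p (contDiffAt_discToRect hb)
      (by fun_prop)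
  have hmodel := contDiffAt_model (K := K)
    (p := (p.1, slant (openPunctures p.2.1) - ((n : ℝ), (n : ℝ)), discToRect p.2.2))
    hε hKε (by rw [← hn]; exact (stripCoord_snd_mem_Ico _).1) (discToRect_mem hb).2.1
  refine (hmodel.comp p (contDiffAt_fst.prodMk (hstrip.prodMk hrect))).congr_of_eventuallyEq ?_
  filter_upwards [(by fun_prop : ContinuousAt (fun p : ℝ × (ℝ × ℝ) × (ℝ × ℝ) ↦ p.2.1) p).eventually
    heq] with p hp
  exact hp _ _

theorem hasPullbackAt_planeMap (hε : 0 < ε) (hKε : K * ε ∈ Set.Ioo 0 (2 * Real.pi))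
    {z b : ℝ × ℝ} (hz : z ∈ puncturedPlane) (hb : normSq b < 1) :
    HasPullbackAt (fun p : (ℝ × ℝ) × (ℝ × ℝ) ↦ planeMap K ε p.1 p.2)
      (prodForm area area) (prodForm (ε • area) area) (z, b) := by
  obtain ⟨n, hn, heq⟩ := planeMap_eventuallyEq K hz
  obtain ⟨-, hmomentum, -⟩ := discToRect_mem hb
  have hv := (stripCoord_snd_mem_Ico z).1
  rw [hn] at hv
  have hstrip := (hasPullbackAt_height_slant hz n).smul (ε / 2)
  rw [smul_smul, div_mul_cancel₀ ε two_ne_zero] at hstrip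
  set w := slant (openPunctures z) - ((n : ℝ), (n : ℝ))
  have hacross := div_pos (offset_pos hε (q := w.1) (height_nonneg w.1 hv) hmomentum.le)
    (speed_pos hKε w.1)
  have hflat := (hasPullbackAt_flatMap hKε _).comp
    (hstrip.prodMap (p := (z, b)) (hasPullbackAt_discToRect hb))
  refine (HasPullbackAt.comp ((hasPullbackAt_polar hacross).prodMap
    (hasPullbackAt_polar hmomentum)) hflat).congr_of_eventuallyEq ?_
  filter_upwards [(continuous_fst.tendsto (z, b)).eventually heq] with p hp
  exact hp _ _

end PlaneMap

/-! ### Descent to the torus -/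

section InChart

variable {𝕜 E H H' M N : Type*} [NontriviallyNormedField 𝕜] [NormedAddCommGroup E]
  [NormedSpace 𝕜 E] [TopologicalSpace H] [TopologicalSpace H'] {I : ModelWithCorners 𝕜 E H}
  {J : ModelWithCorners 𝕜 E H'} [TopologicalSpace M] [ChartedSpace H M] [TopologicalSpace N]
  [ChartedSpace H' N]

theorem hasMFDerivAt_id_of_writtenInExtChartAt {f : M → N} {x : M} (hf : ContinuousAt f x)
    (h : ∀ y ∈ (extChartAt I x).target, writtenInExtChartAt I J x f y = y) :
    HasMFDerivAt I J f x (ContinuousLinearMap.id 𝕜 E) := by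
  refine ⟨hf, (hasFDerivWithinAt_id _ _).congr_of_eventuallyEq ?_ (h _ (mem_extChartAt_target x))⟩
  filter_upwards [extChartAt_target_mem_nhdsWithin (I := I) x] with y hy
  exact h y hy

theorem hasMFDerivAt_opens_val (U : TopologicalSpace.Opens M) (x : U) :
    HasMFDerivAt I I (Subtype.val : U → M) x (ContinuousLinearMap.id 𝕜 E) := by
  refine hasMFDerivAt_id_of_writtenInExtChartAt continuous_subtype_val.continuousAt fun y hy ↦ ?_
  simp only [mfld_simps, TopologicalSpace.Opens.chartAt_eq] at hy ⊢
  rw [← Function.comp_apply (f := Subtype.val),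
    ← OpenPartialHomeomorph.subtypeRestr_symm_eqOn (chartAt H x.1) ⟨x⟩ hy.2,
    (chartAt H x.1).right_inv (OpenPartialHomeomorph.subtypeRestr_target_subset _ _ hy.2),
    I.right_inv hy.1]

theorem hasMFDerivAt_extChartAt_self (x : M) :
    HasMFDerivAt I 𝓘(𝕜, E) (extChartAt I x) x (ContinuousLinearMap.id 𝕜 E) :=
  hasMFDerivAt_id_of_writtenInExtChartAt (continuousAt_extChartAt x) fun _ hy ↦
    (extChartAt I x).right_inv hy

theorem hasMFDerivAt_prodMk_space {F F' : Type*} [NormedAddCommGroup F] [NormedSpace 𝕜 F]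
    [NormedAddCommGroup F'] [NormedSpace 𝕜 F'] {f : M → F} {g : M → F'} {x : M} {f' : E →L[𝕜] F}
    {g' : E →L[𝕜] F'} (hf : HasMFDerivAt I 𝓘(𝕜, F) f x f') (hg : HasMFDerivAt I 𝓘(𝕜, F') g x g') :
    HasMFDerivAt I 𝓘(𝕜, F × F') (fun y ↦ (f y, g y)) x (f'.prod g') :=
  ⟨hf.1.prodMk hg.1, hf.2.prodMk hg.2⟩

end InChart

section Torus

variable {a : ℝ}

theorem coe_addCircle_eq_iff (ha : a ≠ 0) {x y : ℝ} :
    (x : AddCircle a) = y ↔ ∃ m : ℤ, a⁻¹ * y = a⁻¹ * x + m := by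
  rw [QuotientAddGroup.eq, AddSubgroup.mem_zmultiples_iff]
  refine exists_congr fun m ↦ ?_
  rw [zsmul_eq_mul]
  field_simp
  constructor <;> intro h <;> linarith

theorem torusProj_eq_iff (ha : a ≠ 0) {z z' : ℝ × ℝ} :
    torusProj a z = torusProj a z' ↔ ∃ m n : ℤ, a⁻¹ • z' = a⁻¹ • z + ((m : ℝ), (n : ℝ)) := by
  simp only [torusProj, coe_addCircle_eq_iff ha, Prod.ext_iff, Prod.smul_fst,
    Prod.smul_snd, Prod.fst_add, Prod.snd_add, smul_eq_mul, exists_and_left, exists_and_right]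

theorem torusProj_surjective (a : ℝ) : Function.Surjective (torusProj a) := fun σ ↦ by
  obtain ⟨x, hx⟩ := QuotientAddGroup.mk_surjective σ.1
  obtain ⟨y, hy⟩ := QuotientAddGroup.mk_surjective σ.2
  exact ⟨(x, y), Prod.ext hx hy⟩

theorem smul_mem_puncturedPlane (ha : a ≠ 0) {z : ℝ × ℝ} (h : torusProj a z ∈ puncturedTorus a) :
    a⁻¹ • z ∈ puncturedPlane := by
  intro hresidue
  have hlattice : a⁻¹ • z = a⁻¹ • (0 : ℝ × ℝ) + nearestLatticePoint (a⁻¹ • z) := by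
    rw [smul_zero, zero_add]
    exact sub_eq_zero.1 hresidue
  exact h ((torusProj_eq_iff ha).2 ⟨_, _, hlattice⟩).symm

/-- A representative in the plane of a point of the torus. -/
def torusRep (σ : Torus a) : ℝ × ℝ := Function.surjInv (torusProj_surjective a) σ

theorem torusProj_torusRep (σ : Torus a) : torusProj a (torusRep σ) = σ :=
  Function.surjInv_eq _ σ

/-- The map on the torus of side `a` induced by a doubly periodic map of the plane. -/
def descend {X : Type*} (a : ℝ) (f : ℝ × ℝ → X) (σ : Torus a) : X := f (a⁻¹ • torusRep σ)

theorem descend_torusProj {X : Type*} {f : ℝ × ℝ → X} (hf : IsDoublyPeriodic f) (ha : a ≠ 0)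
    (z : ℝ × ℝ) : descend a f (torusProj a z) = f (a⁻¹ • z) := by
  obtain ⟨m, n, h⟩ := (torusProj_eq_iff ha).1 (torusProj_torusRep (torusProj a z)).symm
  rw [descend, h, hf]

/-- The lift of points near `σ₀` to the plane that is given by the chart, rescaled so that the
lattice becomes `ℤ²`. -/
def localLift (σ₀ σ : puncturedTorus a) : ℝ × ℝ :=
  a⁻¹ • extChartAt (𝓘(ℝ).prod 𝓘(ℝ)) σ₀.1 σ.1

theorem torusProj_extChartAt_eventuallyEq (τ : Torus a) :
    ∀ᶠ σ in nhds τ, torusProj a (extChartAt (𝓘(ℝ).prod 𝓘(ℝ)) τ σ) = σ := by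
  have hcoe (x : AddCircle a) : ∀ᶠ y in nhds x, ((chartAt ℝ x y : ℝ) : AddCircle a) = y := by
    filter_upwards [chart_source_mem_nhds ℝ x] with y hy
    rw [← AddCircle.coe_atlas_symm (chart_mem_atlas ℝ x), (chartAt ℝ x).left_inv hy]
  filter_upwards [(continuous_fst.tendsto τ).eventually (hcoe τ.1),
    (continuous_snd.tendsto τ).eventually (hcoe τ.2)] with σ h₁ h₂
  exact Prod.ext h₁ h₂

theorem descend_eventuallyEq (ha : a ≠ 0) (σ₀ : puncturedTorus a) :
    ∀ᶠ σ in nhds σ₀, ∀ {X : Type} {f : ℝ × ℝ → X}, IsDoublyPeriodic f →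
      descend a f σ.1 = f (localLift σ₀ σ) := by
  filter_upwards [(continuous_subtype_val.tendsto σ₀).eventually
    (torusProj_extChartAt_eventuallyEq σ₀.1)] with σ hσ X f hf
  rw [localLift, ← descend_torusProj hf ha, hσ]

theorem localLift_self_mem (ha : a ≠ 0) (σ : puncturedTorus a) :
    localLift σ σ ∈ puncturedPlane :=
  smul_mem_puncturedPlane ha (by
    rw [(torusProj_extChartAt_eventuallyEq σ.1).self_of_nhds]; exact σ.2)

theorem contMDiffAt_localLift (σ₀ : puncturedTorus a) :
    ContMDiffAt (𝓘(ℝ).prod 𝓘(ℝ)) 𝓘(ℝ, ℝ × ℝ) ∞ (localLift σ₀) σ₀ :=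
  (contDiff_const_smul a⁻¹).contMDiff.contMDiffAt.comp σ₀
    (contMDiffAt_extChartAt.comp σ₀ contMDiff_subtype_val.contMDiffAt)

theorem hasMFDerivAt_localLift (σ₀ : puncturedTorus a) :
    HasMFDerivAt (𝓘(ℝ).prod 𝓘(ℝ)) 𝓘(ℝ, ℝ × ℝ) (localLift σ₀) σ₀
      (a⁻¹ • ContinuousLinearMap.id ℝ (ℝ × ℝ)) :=
  ((hasFDerivAt_id _).const_smul a⁻¹).hasMFDerivAt.comp σ₀
    ((hasMFDerivAt_extChartAt_self σ₀.1).comp σ₀ (hasMFDerivAt_opens_val _ σ₀))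

theorem map_nhds_localLift (ha : a ≠ 0) (σ₀ : puncturedTorus a) :
    Filter.map (localLift σ₀) (nhds σ₀) = nhds (localLift σ₀ σ₀) := by
  have hchart := map_extChartAt_nhds_of_boundaryless (I := 𝓘(ℝ).prod 𝓘(ℝ)) σ₀.1
  have hscale := (Homeomorph.smulOfNeZero a⁻¹ (inv_ne_zero ha)).map_nhds_eq
    (extChartAt (𝓘(ℝ).prod 𝓘(ℝ)) σ₀.1 σ₀.1)
  rw [← hchart, ← (puncturedTorus a).isOpenEmbedding'.map_nhds_eq, Filter.map_map,
    Filter.map_map] at hscale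
  exact hscale

end Torus

theorem mem_disc_iff {r : ℝ} (hr : 0 < r) {b : ℝ × ℝ} : b ∈ disc r ↔ normSq b < r ^ 2 :=
  Real.sqrt_lt' hr

theorem normSq_lt_one (b : disc 1) : normSq b.1 < 1 := by
  simpa only [one_pow] using (mem_disc_iff one_pos).1 b.2

/-! ### The embedding -/

/-- The map that `planeMap` induces on the product of the punctured torus of side `a` and the
disc. -/
def puncturedTorusMap (K ε a : ℝ) (p : puncturedTorus a × disc 1) : (ℝ × ℝ) × (ℝ × ℝ) :=
  descend a (fun z ↦ planeMap K ε z p.2.1) p.1.1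

section PuncturedTorusMap

variable {K ε a : ℝ}

theorem puncturedTorusMap_eventuallyEq (K : ℝ) (ha : a ≠ 0) (p₀ : puncturedTorus a × disc 1) :
    ∀ᶠ p in nhds p₀, ∀ ε, puncturedTorusMap K ε a p = planeMap K ε (localLift p₀.1 p.1) p.2.1 := by
  filter_upwards [(continuous_fst.tendsto p₀).eventually (descend_eventuallyEq ha p₀.1)] with p hp ε
  exact hp (isDoublyPeriodic_planeMap _)

theorem puncturedTorusMap_injective (ha : a ≠ 0) (hε : 0 < ε)
    (hKε : K * ε ∈ Set.Ioo 0 (2 * Real.pi)) : Function.Injective (puncturedTorusMap K ε a) := by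
  intro p p' h
  have hmem (σ : puncturedTorus a) : a⁻¹ • torusRep σ.1 ∈ puncturedPlane :=
    smul_mem_puncturedPlane ha (by rw [torusProj_torusRep]; exact σ.2)
  obtain ⟨htranslate, hb⟩ :=
    planeMap_inj hε hKε (hmem p.1) (hmem p'.1) (normSq_lt_one _) (normSq_lt_one _) h
  have hσ := (torusProj_eq_iff ha).2 htranslate
  rw [torusProj_torusRep, torusProj_torusRep] at hσ
  exact Prod.ext (Subtype.ext hσ) (Subtype.ext hb)

theorem contMDiffAt_puncturedTorusMap (ha : a ≠ 0) (hε : 0 < ε)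
    (hKε : K * ε ∈ Set.Ioo 0 (2 * Real.pi)) (p₀ : puncturedTorus a × disc 1) :
    ContMDiffAt (𝓘(ℝ).prod ((𝓘(ℝ).prod 𝓘(ℝ)).prod 𝓘(ℝ, ℝ × ℝ)))
      (𝓘(ℝ, ℝ × ℝ).prod 𝓘(ℝ, ℝ × ℝ)) ∞
      (fun x : ℝ × (puncturedTorus a × disc 1) ↦ puncturedTorusMap K x.1 a x.2) (ε, p₀) := by
  have hplane := (contDiffAt_planeMap (p := (ε, localLift p₀.1 p₀.1, p₀.2.1)) hε hKε
    (localLift_self_mem ha p₀.1) (normSq_lt_one p₀.2)).contMDiffAt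
  have hlift : ContMDiffAt ((𝓘(ℝ).prod 𝓘(ℝ)).prod 𝓘(ℝ, ℝ × ℝ)) 𝓘(ℝ, (ℝ × ℝ) × (ℝ × ℝ)) ∞
      (fun p : puncturedTorus a × disc 1 ↦ (localLift p₀.1 p.1, p.2.1)) p₀ :=
    ((contMDiffAt_localLift p₀.1).comp p₀ contMDiffAt_fst).prodMk_space
      (contMDiff_subtype_val.contMDiffAt.comp p₀ contMDiffAt_snd)
  have hcomp := ContMDiffAt.comp (ε, p₀) hplane
    (contMDiffAt_fst.prodMk_space (hlift.comp (ε, p₀) contMDiffAt_snd))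
  refine ((contMDiffAt_prod_iff _).2 ((contMDiffAt_prod_module_iff _).1 hcomp))
    |>.congr_of_eventuallyEq ?_
  filter_upwards [(continuous_snd.tendsto (ε, p₀)).eventually
    (puncturedTorusMap_eventuallyEq K ha p₀)] with x hx
  exact hx _

theorem contMDiff_puncturedTorusMap (ha : a ≠ 0) (hε : 0 < ε)
    (hKε : K * ε ∈ Set.Ioo 0 (2 * Real.pi)) :
    ContMDiff ((𝓘(ℝ).prod 𝓘(ℝ)).prod 𝓘(ℝ, ℝ × ℝ)) (𝓘(ℝ, ℝ × ℝ).prod 𝓘(ℝ, ℝ × ℝ)) ∞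
      (puncturedTorusMap K ε a) := fun p₀ ↦
  ContMDiffAt.comp (g := fun x : ℝ × (puncturedTorus a × disc 1) ↦ puncturedTorusMap K x.1 a x.2)
    (f := fun p ↦ (ε, p)) p₀ (contMDiffAt_puncturedTorusMap ha hε hKε p₀)
    (contMDiffAt_const.prodMk contMDiffAt_id)

theorem exists_hasMFDerivAt_puncturedTorusMap (ha : 0 < a) (haε : a ^ 2 = ε)
    (hKε : K * ε ∈ Set.Ioo 0 (2 * Real.pi)) (p₀ : puncturedTorus a × disc 1) :
    ∃ f' : (ℝ × ℝ) × (ℝ × ℝ) →L[ℝ] (ℝ × ℝ) × (ℝ × ℝ),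
      HasMFDerivAt ((𝓘(ℝ).prod 𝓘(ℝ)).prod 𝓘(ℝ, ℝ × ℝ)) (𝓘(ℝ, ℝ × ℝ).prod 𝓘(ℝ, ℝ × ℝ))
        (puncturedTorusMap K ε a) p₀ f' ∧
      ∀ u v, prodForm area area (f' u) (f' v) = prodForm area area u v := by
  have hε : 0 < ε := haε ▸ pow_pos ha 2
  obtain ⟨g', hg, hg'⟩ := hasPullbackAt_planeMap hε hKε (localLift_self_mem ha.ne' p₀.1)
    (normSq_lt_one p₀.2)
  have hlift := hasMFDerivAt_prodMk_space
    ((hasMFDerivAt_localLift p₀.1).comp p₀ (hasMFDerivAt_fst p₀))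
    ((hasMFDerivAt_opens_val (I := 𝓘(ℝ, ℝ × ℝ)) (disc 1) p₀.2).comp p₀ (hasMFDerivAt_snd p₀))
  have hcomp := hg.hasMFDerivAt.comp p₀ hlift
  have hfst := (hasFDerivAt_fst (𝕜 := ℝ) (E := ℝ × ℝ) (F := ℝ × ℝ)).hasMFDerivAt.comp p₀ hcomp
  have hsnd := (hasFDerivAt_snd (𝕜 := ℝ) (E := ℝ × ℝ) (F := ℝ × ℝ)).hasMFDerivAt.comp p₀ hcomp
  refine ⟨_, (hfst.prodMk hsnd).congr_of_eventuallyEq ?_,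
    fun u v ↦ (hg' (a⁻¹ • u.1, u.2) (a⁻¹ • v.1, v.2)).trans ?_⟩
  · filter_upwards [puncturedTorusMap_eventuallyEq K ha.ne' p₀] with p hp
    exact hp ε
  · simp only [prodForm_apply, map_smul, LinearMap.smul_apply, smul_eq_mul, ← haε]
    field_simp

theorem isOpenMap_puncturedTorusMap (ha : a ≠ 0) (hε : 0 < ε)
    (hKε : K * ε ∈ Set.Ioo 0 (2 * Real.pi)) : IsOpenMap (puncturedTorusMap K ε a) := by
  refine IsOpenMap.of_nhds_le fun p₀ ↦ le_of_eq ?_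
  have hz := localLift_self_mem ha p₀.1
  have hb := normSq_lt_one p₀.2
  have hlift : Filter.map (fun p : puncturedTorus a × disc 1 ↦ (localLift p₀.1 p.1, p.2.1))
      (nhds p₀) = nhds (localLift p₀.1 p₀.1, p₀.2.1) := by
    rw [nhds_prod_eq, nhds_prod_eq, ← map_nhds_localLift ha,
      ← (disc 1).isOpenEmbedding'.map_nhds_eq, Filter.prod_map_map_eq]
  have hplane := (hasPullbackAt_planeMap hε hKε hz hb).map_nhds_eq
    (separatingLeft_prodForm (separatingLeft_smul separatingLeft_area hε.ne') separatingLeft_area)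
    ((contDiffAt_planeMap (p := (ε, localLift p₀.1 p₀.1, p₀.2.1)) hε hKε hz hb).comp
      (localLift p₀.1 p₀.1, p₀.2.1) (f := fun p ↦ (ε, p)) (by fun_prop)) (by simp)
  have hlocal := puncturedTorusMap_eventuallyEq K ha p₀
  rw [hlocal.self_of_nhds ε, Filter.map_congr (hlocal.mono fun p hp ↦ hp ε), ← hplane, ← hlift,
    Filter.map_map]
  rfl

theorem isSymplecticEmbedding_puncturedTorusMap (ha : 0 < a) (haε : a ^ 2 = ε)
    (hKε : K * ε ∈ Set.Ioo 0 (2 * Real.pi)) :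
    IsSymplecticEmbedding ((puncturedTorusForm a).prod (discForm 1)) (planeForm.prod planeForm)
      (puncturedTorusMap K ε a) where
  contMDiff := contMDiff_puncturedTorusMap ha.ne' (haε ▸ pow_pos ha 2) hKε
  immersion p := by
    obtain ⟨f', hf, hf'⟩ := exists_hasMFDerivAt_puncturedTorusMap ha haε hKε p
    rw [hf.mfderiv]
    exact injective_of_separatingLeft (f := f'.toLinearMap) hf'
      (separatingLeft_prodForm separatingLeft_area separatingLeft_area)
  isEmbedding := by
    have hε : 0 < ε := haε ▸ pow_pos ha 2
    exact (Topology.IsOpenEmbedding.of_continuous_injective_isOpenMap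
      (contMDiff_puncturedTorusMap ha.ne' hε hKε).continuous
      (puncturedTorusMap_injective ha.ne' hε hKε)
      (isOpenMap_puncturedTorusMap ha.ne' hε hKε)).isEmbedding
  pullback_eq := by
    funext p u v
    obtain ⟨f', hf, hf'⟩ := exists_hasMFDerivAt_puncturedTorusMap ha haε hKε p
    simp only [FormField.prod, FormField.pullback, puncturedTorusForm, discForm, mfderiv_fst,
      mfderiv_snd, hf.mfderiv, (hasMFDerivAt_opens_val _ _).mfderiv]
    exact hf' u v

theorem range_puncturedTorusMap_subset (hε : 0 < ε) (hKε : K * ε ≤ 1)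
    (hK : ∀ q, 1 + 2 * totalHeight q ≤ K) :
    Set.range (puncturedTorusMap K ε a) ⊆
      (disc (√2 + K * ε) : Set (ℝ × ℝ)) ×ˢ (disc √2 : Set (ℝ × ℝ)) := by
  rintro _ ⟨p, rfl⟩
  have hKpos : 0 < K := by linarith [hK 0, totalHeight_pos 0]
  obtain ⟨hfst, hsnd⟩ := planeMap_mem_ball hε hKε hK (a⁻¹ • torusRep p.1.1) (normSq_lt_one p.2)
  refine ⟨(mem_disc_iff (by positivity)).2 hfst, (mem_disc_iff (by positivity)).2 ?_⟩
  rwa [Real.sq_sqrt zero_le_two]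

theorem torusProj_smul_torusRep (ha : 0 < a) (σ : puncturedTorus 1) :
    torusProj a (a • torusRep σ.1) = (puncturedTorusScale a ha σ).1 := by
  simp only [puncturedTorusScale]
  conv_rhs => rw [← torusProj_torusRep σ.1]
  simp only [torusProj, AddCircle.equivAddCircle_apply_mk, Prod.smul_fst, Prod.smul_snd,
    smul_eq_mul, inv_one, mul_one, mul_comm]

theorem puncturedTorusMap_scale (K ε : ℝ) (ha : 0 < a) (b : puncturedTorus 1 × disc 1) :
    puncturedTorusMap K ε 1 b = puncturedTorusMap K ε a (puncturedTorusScale a ha b.1, b.2) := by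
  rw [puncturedTorusMap, puncturedTorusMap, ← torusProj_smul_torusRep ha,
    descend_torusProj (isDoublyPeriodic_planeMap _) ha.ne', inv_smul_smul₀ ha.ne', descend,
    inv_one, one_smul]

theorem isSmoothFamily_puncturedTorusMap (hK : 0 < K) :
    IsSmoothFamily ((𝓘(ℝ).prod 𝓘(ℝ)).prod 𝓘(ℝ, ℝ × ℝ)) (𝓘(ℝ, ℝ × ℝ).prod 𝓘(ℝ, ℝ × ℝ))
      (Set.Ioc 0 (1 / K))
      (fun ε hε (b : puncturedTorus 1 × disc 1) ↦
        (puncturedTorusScale √ε (Real.sqrt_pos.2 hε.1) b.1, b.2))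
      (fun ε ↦ puncturedTorusMap K ε √ε) := by
  refine ⟨Set.Ioo 0 (2 / K), fun x ↦ puncturedTorusMap K x.1 1 x.2, isOpen_Ioo,
    fun ε hε ↦ ⟨hε.1, hε.2.trans_lt (div_lt_div_of_pos_right one_lt_two hK)⟩, ?_,
    fun ε hε b ↦ puncturedTorusMap_scale K ε (Real.sqrt_pos.2 hε.1) b⟩
  rintro ⟨ε, p⟩ ⟨⟨hε, hεK⟩, -⟩
  have hKε : K * ε ∈ Set.Ioo 0 (2 * Real.pi) :=
    ⟨mul_pos hK hε, by linarith [(lt_div_iff₀' hK).1 hεK, Real.pi_gt_three]⟩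
  exact (contMDiffAt_puncturedTorusMap one_ne_zero hε hKε p).contMDiffWithinAt

end PuncturedTorusMap

end PuncturedTorus

end

theorem mainTheorem6 :
    ∃ ε₀ : ℝ, 0 < ε₀ ∧ ∃ c : ℝ, 0 < c ∧
      ∃ I : ∀ ε : ℝ, puncturedTorus (Real.sqrt ε) × disc 1 → (ℝ × ℝ) × (ℝ × ℝ),
        (∀ ε ∈ Set.Ioc 0 ε₀,
          IsSymplecticEmbedding ((puncturedTorusForm (Real.sqrt ε)).prod (discForm 1))
            (planeForm.prod planeForm) (I ε) ∧
          Set.range (I ε) ⊆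
            (disc (Real.sqrt 2 + c * ε) : Set (ℝ × ℝ)) ×ˢ (disc (Real.sqrt 2) : Set (ℝ × ℝ))) ∧
        IsSmoothFamily ((𝓘(ℝ).prod 𝓘(ℝ)).prod 𝓘(ℝ, ℝ × ℝ)) (𝓘(ℝ, ℝ × ℝ).prod 𝓘(ℝ, ℝ × ℝ))
          (Set.Ioc 0 ε₀)
          (fun ε hε (b : puncturedTorus 1 × disc 1) =>
            (puncturedTorusScale (Real.sqrt ε) (Real.sqrt_pos.2 hε.1) b.1, b.2))
          I := by
  obtain ⟨C, hC⟩ := PuncturedTorus.exists_totalHeight_le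
  set K := 1 + 2 * C
  have hK (q : ℝ) : 1 + 2 * PuncturedTorus.totalHeight q ≤ K := by linarith [hC q]
  have hKpos : 0 < K := by linarith [hK 0, PuncturedTorus.totalHeight_pos 0]
  refine ⟨1 / K, by positivity, K, hKpos,
    fun ε ↦ PuncturedTorus.puncturedTorusMap K ε (Real.sqrt ε), fun ε ⟨hε, hεK⟩ ↦ ?_,
    PuncturedTorus.isSmoothFamily_puncturedTorusMap hKpos⟩
  have hKε : K * ε ≤ 1 := (le_div_iff₀' hKpos).1 hεK
  have hwidth : K * ε ∈ Set.Ioo 0 (2 * Real.pi) :=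
    ⟨mul_pos hKpos hε, by linarith [Real.pi_gt_three]⟩
  exact ⟨PuncturedTorus.isSymplecticEmbedding_puncturedTorusMap (Real.sqrt_pos.2 hε)
    (Real.sq_sqrt hε.le) hwidth, PuncturedTorus.range_puncturedTorusMap_subset hε hKε hK⟩
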